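/- Let $p$ be a prime, let $G$ be a finite group, and suppose that a Sylow $p$-subgroup $V$ of $G$ is elementary abelian (that is, $V$ is commutative and $v^p=1$ for all $v\in V$). Let $N_G(V)$ be the normalizer of $V$ in $G$ and let $W=N_G(V)/V$. Let $EG$ be any contractible space with a free $G$-action (each $g\in G$ acts continuously, and every point has a neighbourhood disjoint from its translates by all $g\neq 1$; for Hausdorff spaces this just says that all stabilizers are trivial). For a subgroup $H\le G$ put $BH=EG/H$, and write $H^*(H)=H^*(BH;\mathbb F_p)$ for singular cohomology with its cup product. Let $W$ act on $H^*(V)$ by conjugation, i.e. through the maps $BV\to BV$, $Vx\mapsto V(nx)$, for $n\in N_G(V)$. Then: 1. The restriction map $H^*(G)\to H^*(V)$ induced by the projection $BV\to BG$ is an isomorphism of graded $\mathbb F_p$-algebras from $H^*(G)$ onto the subalgebra of invariants $H^*(V)^W$. 2. The map of spaces $BN_G(V)\to BG$ induced by the inclusion $N_G(V)\le G$ is an $H\mathbb Z/p$-equivalence, i.e. it induces an isomorphism $H_n(BN_G(V);\mathbb Z/p)\to H_n(BG;\mathbb Z/p)$ on singular homology for every $n\ge 0$. -/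

import Mathlib

open CategoryTheory Opposite Topology

universe u v

noncomputable section

namespace ModPCoh

/-! ### Cochains of a simplicial set, their cohomology, and the cup product -/

section Cochains

variable (R : Type) [CommRing R] (S : SSet.{v})

/-- The `R`-module of `n`-cochains of a simplicial set: all functions from `n`-simplices to `R`. -/
abbrev Cochain (n : ℕ) : Type v := S.obj (op (.mk n)) → R

/-- The coboundary `(d f) σ = ∑ i, (-1) ^ i * f (d_i σ)`. -/
def coboundary (n : ℕ) : Cochain R S n →ₗ[R] Cochain R S (n + 1) where
  toFun f σ := ∑ i : Fin (n + 2), (-1) ^ (i : ℕ) * f (S.map (SimplexCategory.δ i).op σ)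
  map_add' f g := by
    funext σ
    simp [mul_add, Finset.sum_add_distrib]
  map_smul' r f := by
    funext σ
    simp [Finset.mul_sum, mul_left_comm]

theorem coboundary_coboundary (n : ℕ) (f : Cochain R S n) :
    coboundary R S (n + 1) (coboundary R S n f) = 0 := by
  funext σ
  simp only [coboundary, LinearMap.coe_mk, AddHom.coe_mk, Finset.mul_sum, Pi.zero_apply]
  rw [← Finset.sum_product', Finset.univ_product_univ]
  let P : Fin (n + 3) × Fin (n + 2) → Prop := fun x => (x.2 : ℕ) < x.1
  rw [← Finset.sum_filter_add_sum_filter_not Finset.univ P]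
  rw [add_eq_zero_iff_eq_neg, ← Finset.sum_neg_distrib]
  refine Finset.sum_bij'
    (fun x hx => (x.2.castSucc, ⟨(x.1 : ℕ) - 1, by have := x.1.2; omega⟩))
    (fun x hx => (x.2.succ, ⟨(x.1 : ℕ), by
      have h1 := (Finset.mem_filter.1 hx).2
      have h2 := x.2.2
      simp only [P] at h1
      omega⟩)) ?_ ?_ ?_ ?_ ?_
  · rintro ⟨i, j⟩ hx
    have h1 := (Finset.mem_filter.1 hx).2
    simp only [P] at h1
    simp only [Finset.mem_filter, Finset.mem_univ, true_and, P, Fin.val_castSucc]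
    omega
  · rintro ⟨i, j⟩ hx
    have h1 := (Finset.mem_filter.1 hx).2
    simp only [P] at h1
    simp only [Finset.mem_filter, Finset.mem_univ, true_and, P, Fin.val_succ]
    omega
  · rintro ⟨i, j⟩ hx
    have h1 := (Finset.mem_filter.1 hx).2
    simp only [P] at h1
    ext
    · simp; omega
    · simp
  · rintro ⟨i, j⟩ hx
    ext
    · simp
    · simp
  · rintro ⟨i, j⟩ hx
    have h1 := (Finset.mem_filter.1 hx).2
    simp only [P] at h1
    obtain ⟨i, rfl⟩ : ∃ i' : Fin (n + 2), i = i'.succ := ⟨⟨i - 1, by have := i.2; omega⟩, by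
      ext; simp; omega⟩
    have hji : j ≤ i := by
      rw [Fin.le_def]; simp at h1; omega
    have key : S.map (SimplexCategory.δ j).op (S.map (SimplexCategory.δ i.succ).op σ) =
        S.map (SimplexCategory.δ i).op (S.map (SimplexCategory.δ j.castSucc).op σ) := by
      have := SimplexCategory.δ_comp_δ hji
      have h2 := congrArg (fun φ => S.map φ.op σ) this
      simp only [op_comp, S.map_comp] at h2
      exact h2
    have hi : (⟨((i.succ : Fin (n + 3)) : ℕ) - 1, by have := i.2; simp⟩ : Fin (n + 2)) = i := by
      ext; simp
    rw [hi, key, Fin.val_succ, Fin.val_castSucc]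
    ring

/-- The `n`-cocycles. -/
def cocycles (n : ℕ) : Submodule R (Cochain R S n) := LinearMap.ker (coboundary R S n)

/-- The `n`-coboundaries (there are no nonzero ones in degree `0`). -/
def coboundaries : (n : ℕ) → Submodule R (Cochain R S n)
  | 0 => ⊥
  | n + 1 => LinearMap.range (coboundary R S n)

theorem coboundaries_le_cocycles (n : ℕ) : coboundaries R S n ≤ cocycles R S n := by
  cases n with
  | zero => exact bot_le
  | succ n =>
    rintro _ ⟨f, rfl⟩
    exact coboundary_coboundary R S n f

/-- The cohomology `H^n(S; R)`: cocycles modulo coboundaries. -/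
abbrev Cohomology (n : ℕ) : Type v :=
  cocycles R S n ⧸ (coboundaries R S n).comap (cocycles R S n).subtype

variable {S}

/-- The front `m`-face, on the vertices `0, …, m`, of a `k`-simplex, where `k = m + n`. -/
def frontFace {m n k : ℕ} (h : m + n = k) (σ : S.obj (op (.mk k))) : S.obj (op (.mk m)) :=
  S.map (SimplexCategory.subinterval 0 m (by omega)).op σ

/-- The back `n`-face, on the vertices `m, …, m + n`, of a `k`-simplex, where `k = m + n`. -/
def backFace {m n k : ℕ} (h : m + n = k) (σ : S.obj (op (.mk k))) : S.obj (op (.mk n)) :=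
  S.map (SimplexCategory.subinterval m n (by omega)).op σ

variable {R}

/-- The Alexander-Whitney cup product of cochains; the degree `k` of the product is only required
to be propositionally equal to `m + n`. -/
def cochainCup {m n k : ℕ} (h : m + n = k) (f : Cochain R S m) (g : Cochain R S n) :
    Cochain R S k :=
  fun σ => f (frontFace h σ) * g (backFace h σ)

theorem map_eq_of_val {a b c : ℕ} {α : SimplexCategory.mk a ⟶ .mk b}
    {β : SimplexCategory.mk b ⟶ .mk c} {γ : SimplexCategory.mk a ⟶ .mk c}
    (h : ∀ i : Fin (a + 1), (β.toOrderHom (α.toOrderHom i) : ℕ) = γ.toOrderHom i)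
    (σ : S.obj (op (.mk c))) : S.map α.op (S.map β.op σ) = S.map γ.op σ := by
  have : α ≫ β = γ := by
    apply SimplexCategory.Hom.ext
    ext i
    exact h i
  rw [← this, op_comp, S.map_comp]
  rfl

theorem coe_δ {n : ℕ} (i : Fin (n + 2)) (j : Fin (n + 1)) :
    ((SimplexCategory.δ i).toOrderHom j : ℕ) = if (j : ℕ) < i then (j : ℕ) else j + 1 := by
  change ((Fin.succAbove i j : Fin (n + 2)) : ℕ) = _
  simp only [Fin.succAbove, Fin.lt_def, Fin.val_castSucc]
  split_ifs <;> simp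

theorem coe_subinterval {n : ℕ} (j l : ℕ) (h : j + l ≤ n) (i : Fin (l + 1)) :
    ((SimplexCategory.subinterval j l h).toOrderHom i : ℕ) = i + j := rfl

/-- The Leibniz rule `d (f ∪ g) = d f ∪ g + (-1) ^ m • f ∪ d g`. -/
theorem coboundary_cochainCup {m n k : ℕ} (h : m + n = k) (f : Cochain R S m)
    (g : Cochain R S n) :
    coboundary R S k (cochainCup h f g) =
      cochainCup (show m + 1 + n = k + 1 by omega) (coboundary R S m f) g +
        (-1 : R) ^ m • cochainCup (show m + (n + 1) = k + 1 by omega) f (coboundary R S n g) := by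
  subst h
  funext σ
  have e : (m + 1) + (n + 1) = m + n + 2 := by omega
  have h1 : ∀ i : Fin (m + 1), frontFace (n := n) rfl
      (S.map (SimplexCategory.δ (Fin.cast e (Fin.castAdd (n + 1) i))).op σ) =
      S.map (SimplexCategory.δ i.castSucc).op
        (frontFace (show m + 1 + n = m + n + 1 by omega) σ) := by
    intro i
    unfold frontFace
    refine (map_eq_of_val (γ := SimplexCategory.δ i.castSucc ≫
      SimplexCategory.subinterval 0 (m + 1) (by omega)) ?_ σ).trans
      (map_eq_of_val (fun _ => rfl) σ).symm
    intro j
    simp [coe_δ, coe_subinterval, SimplexCategory.comp_toOrderHom]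
  have h2 : ∀ i : Fin (m + 1), backFace (m := m) (n := n) rfl
      (S.map (SimplexCategory.δ (Fin.cast e (Fin.castAdd (n + 1) i))).op σ) =
      backFace (show m + 1 + n = m + n + 1 by omega) σ := by
    intro i
    unfold backFace
    refine map_eq_of_val ?_ σ
    intro j
    have hi := i.2
    refine (coe_δ _ _).trans ((if_neg ?_).trans ?_)
    · change ¬((j : ℕ) + m < (i : ℕ))
      omega
    · change (j : ℕ) + m + 1 = (j : ℕ) + (m + 1)
      omega
  have h3 : ∀ i : Fin (n + 1), frontFace (n := n) rfl
      (S.map (SimplexCategory.δ (Fin.cast e (Fin.natAdd (m + 1) i))).op σ) =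
      frontFace (show m + (n + 1) = m + n + 1 by omega) σ := by
    intro i
    unfold frontFace
    refine map_eq_of_val ?_ σ
    intro j
    have := j.2
    simp [coe_δ, coe_subinterval]
    omega
  have h4 : ∀ i : Fin (n + 1), backFace (m := m) (n := n) rfl
      (S.map (SimplexCategory.δ (Fin.cast e (Fin.natAdd (m + 1) i))).op σ) =
      S.map (SimplexCategory.δ i.succ).op
        (backFace (show m + (n + 1) = m + n + 1 by omega) σ) := by
    intro i
    unfold backFace
    refine (map_eq_of_val (γ := SimplexCategory.δ i.succ ≫
      SimplexCategory.subinterval m (n + 1) (by omega)) ?_ σ).trans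
      (map_eq_of_val (fun _ => rfl) σ).symm
    intro j
    have e0 : ((SimplexCategory.δ i.succ ≫ SimplexCategory.subinterval m (n + 1)
        (show m + (n + 1) ≤ m + n + 1 by omega)).toOrderHom j : ℕ) =
        (SimplexCategory.δ i.succ).toOrderHom j + m := rfl
    refine (coe_δ _ _).trans (Eq.trans ?_
      (e0.trans (congrArg (fun t => t + m) (coe_δ i.succ j))).symm)
    change (if (j : ℕ) + m < m + 1 + (i : ℕ) then (j : ℕ) + m else (j : ℕ) + m + 1) =
      (if (j : ℕ) < (i : ℕ) + 1 then (j : ℕ) else (j : ℕ) + 1) + m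
    by_cases hij : (j : ℕ) < (i : ℕ) + 1
    · rw [if_pos hij, if_pos (by omega)]
    · rw [if_neg hij, if_neg (by omega)]
      omega
  have h5 : S.map (SimplexCategory.δ (Fin.last (m + 1))).op
        (frontFace (show m + 1 + n = m + n + 1 by omega) σ) =
      frontFace (show m + (n + 1) = m + n + 1 by omega) σ := by
    unfold frontFace
    refine map_eq_of_val ?_ σ
    intro j
    have := j.2
    simp [coe_δ, coe_subinterval]
    omega
  have h6 : S.map (SimplexCategory.δ (0 : Fin (n + 2))).op
        (backFace (show m + (n + 1) = m + n + 1 by omega) σ) =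
      backFace (show m + 1 + n = m + n + 1 by omega) σ := by
    unfold backFace
    refine map_eq_of_val ?_ σ
    intro j
    simp [coe_δ, coe_subinterval]
    omega
  simp only [coboundary, LinearMap.coe_mk, AddHom.coe_mk, cochainCup, Pi.add_apply, Pi.smul_apply,
    smul_eq_mul]
  rw [← (finCongr e).sum_comp, Fin.sum_univ_add, Fin.sum_univ_castSucc (n := m + 1),
    Fin.sum_univ_succ (n := n + 1)]
  simp only [finCongr_apply, h1, h2, h3, h4, h5, h6, Fin.val_cast, Fin.val_castAdd,
    Fin.val_natAdd, Fin.val_castSucc, Fin.val_succ, Fin.val_last, Fin.val_zero]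
  have e1 : ∀ i : Fin (n + 1), ∀ a b : R,
      (-1) ^ (m + 1 + (i : ℕ)) * (a * b) = (-1) ^ m * (a * ((-1) ^ ((i : ℕ) + 1) * b)) := by
    intro i a b
    ring
  have e2 : ∀ x y a b : R, x + y = x + (-1) ^ (m + 1) * (a * b) +
      ((-1) ^ m * (a * ((-1) ^ 0 * b)) + y) := by
    intro x y a b
    ring
  simp only [e1, add_mul, Finset.sum_mul, mul_add, Finset.mul_sum, mul_assoc]
  exact e2 _ _ _ _

theorem cochainCup_mem_cocycles {m n k : ℕ} (h : m + n = k) {f : Cochain R S m}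
    {g : Cochain R S n} (hf : f ∈ cocycles R S m) (hg : g ∈ cocycles R S n) :
    cochainCup h f g ∈ cocycles R S k := by
  have hf' : coboundary R S m f = 0 := hf
  have hg' : coboundary R S n g = 0 := hg
  change coboundary R S k _ = 0
  rw [coboundary_cochainCup, hf', hg']
  funext σ
  simp [cochainCup]

theorem cochainCup_mem_coboundaries_left {m n k : ℕ} (h : m + n = k) {f : Cochain R S m}
    {g : Cochain R S n} (hf : f ∈ coboundaries R S m) (hg : g ∈ cocycles R S n) :
    cochainCup h f g ∈ coboundaries R S k := by
  have hg' : coboundary R S n g = 0 := hg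
  cases m with
  | zero =>
    have hf0 : f = 0 := hf
    have : cochainCup h f g = 0 := by
      funext σ
      simp [cochainCup, hf0]
    rw [this]
    exact zero_mem _
  | succ m =>
    obtain ⟨f, rfl⟩ := hf
    obtain ⟨k, rfl⟩ : ∃ k', k = k' + 1 := ⟨m + n, by omega⟩
    refine ⟨cochainCup (show m + n = k by omega) f g, ?_⟩
    rw [coboundary_cochainCup, hg']
    funext σ
    simp [cochainCup]

theorem cochainCup_mem_coboundaries_right {m n k : ℕ} (h : m + n = k) {f : Cochain R S m}
    {g : Cochain R S n} (hf : f ∈ cocycles R S m) (hg : g ∈ coboundaries R S n) :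
    cochainCup h f g ∈ coboundaries R S k := by
  have hf' : coboundary R S m f = 0 := hf
  cases n with
  | zero =>
    have hg0 : g = 0 := hg
    have : cochainCup h f g = 0 := by
      funext σ
      simp [cochainCup, hg0]
    rw [this]
    exact zero_mem _
  | succ n =>
    obtain ⟨g, rfl⟩ := hg
    obtain ⟨k, rfl⟩ : ∃ k', k = k' + 1 := ⟨m + n, by omega⟩
    refine ⟨(-1 : R) ^ m • cochainCup (show m + n = k by omega) f g, ?_⟩
    rw [map_smul, coboundary_cochainCup, hf', smul_add, smul_smul, ← mul_pow]
    funext σ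
    simp [cochainCup]

/-- The cup product of cocycles, as a bilinear map. -/
def cocycleCup {m n k : ℕ} (h : m + n = k) :
    cocycles R S m →ₗ[R] cocycles R S n →ₗ[R] cocycles R S k :=
  LinearMap.mk₂ R (fun f g => ⟨cochainCup h f.1 g.1, cochainCup_mem_cocycles h f.2 g.2⟩)
    (fun f₁ f₂ g => by
      ext σ
      simp [cochainCup, add_mul])
    (fun c f g => by
      ext σ
      simp [cochainCup, mul_assoc])
    (fun f g₁ g₂ => by
      ext σ
      simp [cochainCup, mul_add])
    (fun c f g => by
      ext σ
      simp [cochainCup, mul_left_comm])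

variable (R S) in
/-- The cup product `H^m(S; R) × H^n(S; R) → H^k(S; R)`, where `k = m + n`. -/
def cup {m n k : ℕ} (h : m + n = k) :
    Cohomology R S m →ₗ[R] Cohomology R S n →ₗ[R] Cohomology R S k :=
  Submodule.liftQ _
    (LinearMap.mk₂ R
      (fun f (y : Cohomology R S n) =>
        Submodule.mapQ _ ((coboundaries R S k).comap (cocycles R S k).subtype)
          (cocycleCup h f)
          (fun g hg => cochainCup_mem_coboundaries_right h f.2 hg) y)
      (fun f₁ f₂ y => by
        induction y using Submodule.Quotient.induction_on with
        | H g =>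
          exact congrArg Submodule.Quotient.mk
            (congrArg (fun φ => φ g) (map_add (cocycleCup h) f₁ f₂)))
      (fun c f y => by
        induction y using Submodule.Quotient.induction_on with
        | H g =>
          exact congrArg Submodule.Quotient.mk
            (congrArg (fun φ => φ g) (map_smul (cocycleCup h) c f)))
      (fun f y₁ y₂ => map_add _ _ _)
      (fun c f y => map_smul _ _ _))
    (by
      intro f hf
      rw [LinearMap.mem_ker]
      ext y
      exact (Submodule.Quotient.mk_eq_zero _).2 (cochainCup_mem_coboundaries_left h hf y.2))

/-- The cup product on classes is computed by the cup product of representing cocycles. -/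
theorem cup_mk {m n k : ℕ} (h : m + n = k) (f : cocycles R S m) (g : cocycles R S n) :
    cup R S h (Submodule.Quotient.mk f : Cohomology R S m) (Submodule.Quotient.mk g) =
      (Submodule.Quotient.mk ⟨cochainCup h f.1 g.1, cochainCup_mem_cocycles h f.2 g.2⟩ :
        Cohomology R S k) :=
  rfl

variable (R S)

theorem const_one_mem_cocycles : (fun _ => 1 : Cochain R S 0) ∈ cocycles R S 0 := by
  change coboundary R S 0 _ = 0
  funext σ
  simp [coboundary, Fin.sum_univ_two]

/-- The unit class `1 ∈ H^0(S; R)`, represented by the constant cochain `1`. -/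
def unitClass : Cohomology R S 0 :=
  Submodule.Quotient.mk ⟨fun _ => 1, const_one_mem_cocycles R S⟩

variable {S} {T : SSet.{v}}

/-- Pullback of cochains along a map of simplicial sets. -/
def cochainPullback (φ : S ⟶ T) (n : ℕ) : Cochain R T n →ₗ[R] Cochain R S n where
  toFun f σ := f (φ.app (op (.mk n)) σ)
  map_add' _ _ := rfl
  map_smul' _ _ := rfl

theorem coboundary_cochainPullback (φ : S ⟶ T) (n : ℕ) (f : Cochain R T n) :
    coboundary R S n (cochainPullback R φ n f) =
      cochainPullback R φ (n + 1) (coboundary R T n f) := by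
  funext σ
  have key : ∀ i : Fin (n + 2), φ.app (op (.mk n)) (S.map (SimplexCategory.δ i).op σ) =
      T.map (SimplexCategory.δ i).op (φ.app (op (.mk (n + 1))) σ) := fun i =>
    NatTrans.naturality_apply φ (SimplexCategory.δ i).op σ
  simp only [coboundary, cochainPullback, LinearMap.coe_mk, AddHom.coe_mk, key]

/-- Pullback of cocycles along a map of simplicial sets. -/
def cocyclePullback (φ : S ⟶ T) (n : ℕ) : cocycles R T n →ₗ[R] cocycles R S n :=
  (cochainPullback R φ n).restrict fun f hf => by
    have hf' : coboundary R T n f = 0 := hf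
    change coboundary R S n _ = 0
    rw [coboundary_cochainPullback, hf', map_zero]

theorem cochainPullback_mem_coboundaries (φ : S ⟶ T) (n : ℕ) {f : Cochain R T n}
    (hf : f ∈ coboundaries R T n) : cochainPullback R φ n f ∈ coboundaries R S n := by
  cases n with
  | zero =>
    have hf0 : f = 0 := hf
    rw [hf0, map_zero]
    exact zero_mem _
  | succ n =>
    obtain ⟨f, rfl⟩ := hf
    exact ⟨cochainPullback R φ n f, coboundary_cochainPullback R φ n f⟩

/-- The map induced on cohomology by a map of simplicial sets. -/
def pullback (φ : S ⟶ T) (n : ℕ) : Cohomology R T n →ₗ[R] Cohomology R S n :=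
  Submodule.mapQ _ _ (cocyclePullback R φ n)
    (fun _ hf => cochainPullback_mem_coboundaries R φ n hf)

theorem pullback_id (n : ℕ) : pullback R (𝟙 S) n = LinearMap.id := by
  ext x
  rfl

theorem pullback_comp {U : SSet.{v}} (φ : S ⟶ T) (ψ : T ⟶ U) (n : ℕ) :
    pullback R (φ ≫ ψ) n = pullback R φ n ∘ₗ pullback R ψ n := by
  ext x
  rfl

end Cochains

/-! ### Singular cohomology and mod `p` homology of spaces -/

section Spaces

variable (R : Type) [CommRing R] (X : Type v) [TopologicalSpace X]

/-- The singular simplicial set of a topological space. -/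
abbrev Sing : SSet.{v} := TopCat.toSSet.obj (TopCat.of X)

/-- The singular cohomology `H^n(X; R)`. -/
abbrev SingularCohomology (n : ℕ) : Type v := Cohomology R (Sing X) n

variable {X} {Y : Type v} [TopologicalSpace Y]

/-- The map `f^* : H^n(Y; R) → H^n(X; R)` induced by a continuous map `f : X → Y`. -/
def singularPullback (f : C(X, Y)) (n : ℕ) :
    SingularCohomology R Y n →ₗ[R] SingularCohomology R X n :=
  pullback R (TopCat.toSSet.map (TopCat.ofHom f)) n

theorem singularPullback_id (n : ℕ) :
    singularPullback R (ContinuousMap.id X) n = LinearMap.id := by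
  have : TopCat.toSSet.map (TopCat.ofHom (ContinuousMap.id X)) = 𝟙 (Sing X) :=
    TopCat.toSSet.map_id _
  rw [singularPullback, this, pullback_id]

theorem singularPullback_comp {Z : Type v} [TopologicalSpace Z] (f : C(X, Y)) (g : C(Y, Z))
    (n : ℕ) : singularPullback R (g.comp f) n =
      singularPullback R f n ∘ₗ singularPullback R g n := by
  have : TopCat.toSSet.map (TopCat.ofHom (g.comp f)) =
      TopCat.toSSet.map (TopCat.ofHom f) ≫ TopCat.toSSet.map (TopCat.ofHom g) := by
    rw [← TopCat.toSSet.map_comp, ← TopCat.ofHom_comp]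
  rw [singularPullback, this, pullback_comp]
  rfl

/-- A map of spaces is an `Hℤ/p`-equivalence if it induces an isomorphism on singular homology with
coefficients in `ℤ/p` in every degree. -/
def IsHZModEquivalence (p : ℕ) (f : C(X, Y)) : Prop :=
  ∀ n : ℕ, IsIso (((AlgebraicTopology.singularHomologyFunctor (ModuleCat.{v} (ZMod p)) n).obj
    (ModuleCat.of (ZMod p) (ULift.{v} (ZMod p)))).map (TopCat.ofHom f))

end Spaces

/-! ### Classifying spaces -/

section Classifying

variable (G : Type u) [Group G] (E : Type v) [TopologicalSpace E] [MulAction G E]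

/-- A model of `EG` for a discrete group `G`: a contractible space on which `G` acts freely.
As usual for `G`-spaces, each `g : G` acts continuously, and freeness is meant in the sense of
covering spaces: every point has a neighbourhood disjoint from all its translates by elements
`g ≠ 1`. For an action of a finite group on a Hausdorff space this only says that all stabilizers
are trivial, see `IsUniversalSpace.of_t2`. -/
structure IsUniversalSpace [ContinuousConstSMul G E] : Prop where
  contractible : ContractibleSpace E
  free : ∀ x : E, ∃ U ∈ 𝓝 x, ∀ g : G, ((g • ·) '' U ∩ U).Nonempty → g = 1

theorem IsUniversalSpace.of_t2 [Finite G] [ContinuousConstSMul G E] [T2Space E]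
    [ContractibleSpace E] (h : ∀ (g : G) (x : E), g • x = x → g = 1) : IsUniversalSpace G E where
  contractible := inferInstance
  free x := by
    have key : ∀ g : G, ∃ U ∈ 𝓝 x, ((g • ·) '' U ∩ U).Nonempty → g = 1 := by
      intro g
      by_cases hg : g = 1
      · exact ⟨Set.univ, Filter.univ_mem, fun _ => hg⟩
      · obtain ⟨A, B, hA, hB, hxA, hxB, hAB⟩ := t2_separation (fun e => hg (h g x e))
        refine ⟨B ∩ (g • ·) ⁻¹' A, Filter.inter_mem (hB.mem_nhds hxB)
          ((hA.preimage (continuous_const_smul g)).mem_nhds hxA), ?_⟩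
        rintro ⟨_, ⟨y, hy, rfl⟩, hy'⟩
        exact absurd hy'.1 (Set.disjoint_left.1 hAB hy.2)
    choose U hU hU' using key
    refine ⟨⋂ g, U g, (Filter.iInter_mem).2 hU, fun g hg => hU' g (hg.mono ?_)⟩
    exact Set.inter_subset_inter (Set.image_mono (Set.iInter_subset U g)) (Set.iInter_subset U g)

/-- Every group has a model of `EG`: the functions `[0, 1) → G`, with the pseudometric given by the
(outer) measure of the set on which two functions differ. The action is by left multiplication, and
a contraction replaces `f` by the constant `1` on growing intervals `[0, t)`. -/
theorem exists_isUniversalSpace (G : Type u) [Group G] :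
    ∃ (E : Type u) (_ : TopologicalSpace E) (_ : MulAction G E) (_ : ContinuousConstSMul G E),
      IsUniversalSpace G E := by
  let I : Type := Set.Ico (0 : ℝ) 1
  let μ : MeasureTheory.Measure I := MeasureTheory.Measure.comap Subtype.val MeasureTheory.volume
  have hμ : ∀ s : Set I, μ s = MeasureTheory.volume (Subtype.val '' s) := fun s =>
    comap_subtype_coe_apply measurableSet_Ico _ s
  let M : PseudoEMetricSpace (I → G) :=
    { edist := fun f g => μ {x | f x ≠ g x}
      edist_self := fun f => by simp
      edist_comm := fun f g => by simp [ne_comm]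
      edist_triangle := fun f g h => by
        refine (MeasureTheory.measure_mono ?_).trans (MeasureTheory.measure_union_le _ _)
        intro x hne
        by_cases hfg : f x = g x
        · exact Or.inr fun h' => hne (hfg.trans h')
        · exact Or.inl hfg }
  let T : TopologicalSpace (I → G) := M.toUniformSpace.toTopologicalSpace
  have hT : ∀ f g : I → G, edist f g = μ {x | f x ≠ g x} := fun _ _ => rfl
  have hsm : ∀ (a : G) (f g : I → G), edist (a • f) (a • g) = edist f g := by
    intro a f g
    simp [hT]
  let C : ContinuousConstSMul G (I → G) :=
    ⟨fun a => (show Isometry (fun f : I → G => a • f) from hsm a).continuous⟩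
  refine ⟨I → G, T, inferInstance, C, ?_, ?_⟩
  · rw [contractible_iff_id_nullhomotopic]
    let F : unitInterval × (I → G) → (I → G) := fun q x => if x.1 < q.1.1 then 1 else q.2 x
    have hle : ∀ q r, edist (F q) (F r) ≤ ENNReal.ofReal |r.1.1 - q.1.1| + edist q.2 r.2 := by
      rintro ⟨s, f⟩ ⟨t, g⟩
      have h1 : {x | F (s, f) x ≠ F (t, g) x} ⊆
          {x : I | x.1 ∈ Set.uIcc s.1 t.1} ∪ {x | f x ≠ g x} := by
        intro x hx
        by_cases hs : x.1 < s.1 <;> by_cases ht : x.1 < t.1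
        · simp [F, hs, ht] at hx
        · exact Or.inl (Set.mem_uIcc.2 (Or.inr ⟨not_lt.1 ht, hs.le⟩))
        · exact Or.inl (Set.mem_uIcc.2 (Or.inl ⟨not_lt.1 hs, ht.le⟩))
        · right
          simpa [F, hs, ht] using hx
      refine ((MeasureTheory.measure_mono h1).trans (MeasureTheory.measure_union_le _ _)).trans
        (add_le_add ?_ le_rfl)
      rw [hμ]
      refine (MeasureTheory.measure_mono (t := Set.uIcc s.1 t.1) ?_).trans_eq Real.volume_interval
      rintro _ ⟨x, hx, rfl⟩
      exact hx
    have hF : Continuous F := by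
      rw [continuous_iff_continuousAt]
      intro q
      rw [ContinuousAt, tendsto_iff_edist_tendsto_0]
      refine tendsto_of_tendsto_of_tendsto_of_le_of_le tendsto_const_nhds
        (h := fun r => ENNReal.ofReal |q.1.1 - r.1.1| + edist r.2 q.2) ?_
        (fun _ => zero_le) (fun r => hle r q)
      have hc1 : Continuous fun r : unitInterval × (I → G) => ENNReal.ofReal |q.1.1 - r.1.1| :=
        ENNReal.continuous_ofReal.comp (by fun_prop)
      have hc2 : Continuous fun r : unitInterval × (I → G) => edist r.2 q.2 :=
        continuous_snd.edist continuous_const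
      have := (hc1.add hc2).tendsto q
      simpa [Pi.add_def] using this
    refine ⟨fun _ => 1, ⟨⟨⟨F, hF⟩, ?_, ?_⟩⟩⟩
    · intro f
      funext x
      exact if_neg (not_lt.2 x.2.1)
    · intro f
      funext x
      exact if_pos x.2.2
  · intro f
    refine ⟨{g | edist g f < 1 / 2}, Metric.eball_mem_nhds f (by norm_num), ?_⟩
    rintro a ⟨_, ⟨g, hg, rfl⟩, hg'⟩
    by_contra ha
    have h1 : edist (a • g) g = 1 := by
      have : {x | (a • g) x ≠ g x} = Set.univ := by
        ext x
        simpa using ha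
      rw [hT, this, hμ, Set.image_univ, Subtype.range_coe, Real.volume_Ico]
      simp
    have h2 : edist (a • g) g < 1 / 2 + 1 / 2 :=
      (edist_triangle_right _ _ f).trans_lt (ENNReal.add_lt_add hg' hg)
    rw [h1, ENNReal.add_halves] at h2
    exact lt_irrefl _ h2

/-- The classifying space `BG = EG / G`, with the quotient topology, built from a model `E`
of `EG`. For a subgroup `H` of `G` the same `E` is a model of `EH`, and `BH = E / H`. -/
abbrev ClassifyingSpace : Type v := Quotient (MulAction.orbitRel G E)

variable {G}

/-- The map `BH → BG` induced by the inclusion of a subgroup `H` of `G`: the projection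
`E / H → E / G`. -/
def classifyingMap (H : Subgroup G) : C(ClassifyingSpace H E, ClassifyingSpace G E) where
  toFun := Quotient.map' id fun x y hxy => by
    obtain ⟨h, rfl⟩ := hxy
    exact ⟨(h : G), rfl⟩
  continuous_toFun := continuous_quot_lift _ continuous_quotient_mk'

/-- An elementary abelian `p`-subgroup: commutative, and every element has `p`-th power `1`. -/
def IsElementaryAbelian (p : ℕ) (V : Subgroup G) : Prop :=
  (∀ x ∈ V, ∀ y ∈ V, x * y = y * x) ∧ ∀ x ∈ V, x ^ p = 1

/-- The Weyl group `W = N_G(V) / V`. -/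
abbrev WeylGroup (V : Subgroup G) : Type u :=
  Subgroup.normalizer (V : Set G) ⧸ V.subgroupOf (Subgroup.normalizer (V : Set G))

variable [ContinuousConstSMul G E] (V : Subgroup G)

/-- For `n ∈ N_G(V)`, the self-map `V x ↦ V (n x)` of `BV = E / V`. It is covered by `x ↦ n x`,
which is equivariant along the conjugation `v ↦ n v n⁻¹`, so that it is the map induced on
classifying spaces by this conjugation. -/
def conjMap (n : Subgroup.normalizer (V : Set G)) :
    C(ClassifyingSpace V E, ClassifyingSpace V E) where
  toFun := Quotient.map' (fun x => (n : G) • x) fun x y hxy => by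
    obtain ⟨v, rfl⟩ := hxy
    refine ⟨⟨(n : G) * v * (n : G)⁻¹, (n.2 (v : G)).1 v.2⟩, ?_⟩
    change ((n : G) * v * (n : G)⁻¹) • (n : G) • y = (n : G) • (v : G) • y
    simp [smul_smul]
  continuous_toFun :=
    continuous_quot_lift _ (continuous_quotient_mk'.comp (continuous_const_smul (n : G)))

theorem conjMap_one : conjMap E V 1 = ContinuousMap.id _ := by
  ext x
  induction x using Quotient.inductionOn with
  | h x => exact congrArg _ (one_smul G x)

theorem conjMap_mul (a b : Subgroup.normalizer (V : Set G)) :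
    conjMap E V (a * b) = (conjMap E V a).comp (conjMap E V b) := by
  ext x
  induction x using Quotient.inductionOn with
  | h x => exact congrArg _ (mul_smul (a : G) (b : G) x)

theorem conjMap_of_mem (n : Subgroup.normalizer (V : Set G)) (hn : (n : G) ∈ V) :
    conjMap E V n = ContinuousMap.id _ := by
  ext x
  induction x using Quotient.inductionOn with
  | h x => exact Quotient.sound ⟨⟨n, hn⟩, rfl⟩

variable (R : Type) [CommRing R]

/-- The action of `N_G(V)` on `H^n(BV; R)` by conjugation; `a` acts by the map induced by
conjugation with `a⁻¹`, which makes this a left action. -/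
def normalizerRep (n : ℕ) : Representation R (Subgroup.normalizer (V : Set G))
    (SingularCohomology R (ClassifyingSpace V E) n) where
  toFun a := singularPullback R (conjMap E V a⁻¹) n
  map_one' := by
    rw [inv_one, conjMap_one, singularPullback_id]
    rfl
  map_mul' a b := by
    rw [mul_inv_rev, conjMap_mul, singularPullback_comp]
    rfl

/-- The induced action of the Weyl group `W = N_G(V) / V` on `H^n(BV; R)`. -/
def weylRep (n : ℕ) : Representation R (WeylGroup V)
    (SingularCohomology R (ClassifyingSpace V E) n) :=
  QuotientGroup.lift _ (normalizerRep E V R n) fun a ha => by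
    have ha' : ((a⁻¹ : Subgroup.normalizer (V : Set G)) : G) ∈ V :=
      V.inv_mem (Subgroup.mem_subgroupOf.1 ha)
    change singularPullback R (conjMap E V a⁻¹) n = 1
    rw [conjMap_of_mem E V _ ha', singularPullback_id]
    rfl

end Classifying

end ModPCoh

end

/-! For every subgroup `H` of `G` the projection `E → E / H` is a covering. Singular simplices of
`BH` lift to `E`, uniquely up to `H`, so cochains on `BH` are the `H`-invariant cochains on `E`. The
theorem thus concerns invariants in one complex of representations of `G`, the cochains on `E`.

Since the index of `V` is prime to `p`, averaging over `G ⧸ V` turns a `V`-invariant primitive of a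
`G`-invariant cochain into a `G`-invariant one. Hence restriction to `V` is injective. For
surjectivity, let `f` be a `V`-invariant cocycle whose class is fixed by the normalizer. For `g` in
`G` put `Q = V ∩ gVg⁻¹`. As `V` is abelian, `V` and `gVg⁻¹` are Sylow subgroups of the centralizer
of `Q`, so some `c` centralizing `Q` has `c * g` in the normalizer
(`exists_centralizing_mul_mem_normalizer`). An element centralizing `Q` acts trivially on the
cohomology of the `Q`-invariant cochains (`exists_invariant_coboundaryTo_eq`), so `g f - f` has a
`Q`-invariant primitive. Here `Q` is the stabilizer in `V` of the coset `gV`, so the primitives can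
be chosen `V`-equivariantly over `G ⧸ V`. Averaging then gives a `G`-invariant cocycle cohomologous
to `f` through a `V`-invariant cochain (`exists_invariant_sub_mem_boundaries`).

A cocycle on `BN_G(V)` satisfies the same stability condition, so restriction from `G` to the
normalizer is bijective in cohomology. Duality over the field `ZMod p`
(`isIso_homologyMap_of_bijective_pullback`) carries this over to homology. -/

noncomputable section

namespace ModPCoh

/-! ### Sylow fusion, transfer and stable elements -/

section Algebra

/-- An equivariant choice: if every `x` admits some `m` with `P x m` fixed by the stabilizer
of `x`, then such an `m` can be chosen equivariantly in `x`. -/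
theorem exists_equivariant_choice {Γ X M : Type*} [Group Γ] (α : Γ → X → X) (β : Γ → M → M)
    (α_one : ∀ x, α 1 x = x) (α_mul : ∀ g h x, α (g * h) x = α g (α h x))
    (β_mul : ∀ g h m, β (g * h) m = β g (β h m))
    (P : X → M → Prop) (hP : ∀ g x m, P x m → P (α g x) (β g m))
    (hex : ∀ x, ∃ m, P x m ∧ ∀ g, α g x = x → β g m = m) :
    ∃ b : X → M, (∀ x, P x (b x)) ∧ ∀ g x, b (α g x) = β g (b x) := by
  have α_inv : ∀ g x, α g⁻¹ (α g x) = x := fun g x => by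
    rw [← α_mul, inv_mul_cancel, α_one]
  let s : Setoid X :=
    { r := fun x y => ∃ g, α g x = y
      iseqv := ⟨fun x => ⟨1, α_one x⟩, fun {x y} ⟨g, h⟩ => ⟨g⁻¹, by rw [← h, α_inv]⟩,
        fun {x y z} ⟨g, h⟩ ⟨g', h'⟩ => ⟨g' * g, by rw [α_mul, h, h']⟩⟩ }
  let r : X → X := fun x => (Quotient.mk s x).out
  have hr : ∀ x, ∃ g, α g (r x) = x := fun x => Quotient.mk_out (s := s) x
  choose t ht using hr
  choose m hm hm' using hex
  refine ⟨fun x => β (t x) (m (r x)), fun x => ?_, fun g x => ?_⟩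
  · have := hP (t x) _ _ (hm (r x))
    rwa [ht] at this
  · have e : r (α g x) = r x :=
      congrArg Quotient.out (Quotient.sound (s := s) ⟨g⁻¹, α_inv g x⟩)
    -- The value transported from the orbit representative is independent of the transporting
    -- element, because two such elements differ by a stabilizing one, which fixes `m (r x)`.
    have h1 : α ((t x)⁻¹ * (g⁻¹ * t (α g x))) (r x) = r x := by
      have h2 : α (t (α g x)) (r x) = α g x := by rw [← e, ht]
      rw [α_mul, α_mul, h2, α_inv]
      have h3 := α_inv (t x) (r x)
      rwa [ht] at h3
    have h3 := hm' _ _ h1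
    change β (t (α g x)) (m (r (α g x))) = β g (β (t x) (m (r x)))
    rw [e]
    conv_rhs => rw [← h3]
    rw [← β_mul, ← β_mul]
    congr 1
    group

/-- Two conjugates of an abelian Sylow subgroup `V` are conjugate by an element centralizing their
intersection. -/
theorem exists_centralizing_mul_mem_normalizer {p : ℕ} [Fact p.Prime] {G : Type*} [Group G]
    [Finite G] (V : Sylow p G) (hV : ∀ x ∈ (V : Subgroup G), ∀ y ∈ (V : Subgroup G), x * y = y * x)
    (g : G) :
    ∃ c : G, (∀ q ∈ (V : Subgroup G), g⁻¹ * q * g ∈ (V : Subgroup G) → c * q = q * c) ∧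
      c * g ∈ Subgroup.normalizer ((V : Subgroup G) : Set G) := by
  -- `Q` is `V ∩ gVg⁻¹`. Both conjugates are abelian and contain it, so both are Sylow subgroups of
  -- its centralizer and are conjugate there.
  let Q : Set G := {q | q ∈ (V : Subgroup G) ∧ g⁻¹ * q * g ∈ (V : Subgroup G)}
  have h1 : (V : Subgroup G) ≤ Subgroup.centralizer Q := fun x hx =>
    Subgroup.mem_centralizer_iff.2 fun q hq => hV q hq.1 x hx
  have h2 : ((g • V : Sylow p G) : Subgroup G) ≤ Subgroup.centralizer Q := by
    rintro - ⟨z, hz, rfl⟩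
    refine Subgroup.mem_centralizer_iff.2 fun q hq => ?_
    have := hV _ hq.2 z hz
    change q * (g * z * g⁻¹) = (g * z * g⁻¹) * q
    calc q * (g * z * g⁻¹) = g * ((g⁻¹ * q * g) * z) * g⁻¹ := by group
      _ = (g * z * g⁻¹) * q := by rw [this]; group
  obtain ⟨h, hh⟩ :=
    MulAction.exists_smul_eq (Subgroup.centralizer Q) ((g • V).subtype h2) (V.subtype h1)
  simp_rw [Sylow.smul_subtype, Subgroup.smul_def, smul_smul] at hh
  refine ⟨h, fun q hq hq' => (Subgroup.mem_centralizer_iff.1 h.2 q ⟨hq, hq'⟩).symm, ?_⟩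
  exact Sylow.smul_eq_iff_mem_normalizer.mp (Sylow.subtype_injective hh)

variable {k : Type*} [Field k] {G : Type*} [Group G]
  {M M' : Type*} [AddCommGroup M] [Module k M] [AddCommGroup M'] [Module k M']

/-- The map `g V ↦ g x` for an element `x` fixed by `V`. -/
def cosetOrbit (ρ : Representation k G M) (V : Subgroup G) (x : M) (hx : ∀ v ∈ V, ρ v x = x) :
    G ⧸ V → M :=
  Quotient.lift (fun g => ρ g x) fun a b hab => by
    have h := hx _ (QuotientGroup.leftRel_apply.1 hab)
    calc ρ a x = ρ a (ρ (a⁻¹ * b) x) := by rw [h]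
      _ = ρ b x := by rw [← Module.End.mul_apply, ← map_mul, mul_inv_cancel_left]

theorem cosetOrbit_mk (ρ : Representation k G M) (V : Subgroup G) (x : M)
    (hx : ∀ v ∈ V, ρ v x = x) (g : G) : cosetOrbit ρ V x hx (g : G ⧸ V) = ρ g x := rfl

theorem cosetOrbit_smul (ρ : Representation k G M) (V : Subgroup G) (x : M)
    (hx : ∀ v ∈ V, ρ v x = x) (g : G) (c : G ⧸ V) :
    cosetOrbit ρ V x hx (g • c) = ρ g (cosetOrbit ρ V x hx c) := by
  induction c using QuotientGroup.induction_on with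
  | H a =>
    change ρ (g * a) x = ρ g (ρ a x)
    rw [map_mul, Module.End.mul_apply]

/-- The sum of an equivariant family indexed by `G ⧸ V` is invariant. -/
theorem apply_sum_of_equivariant (ρ : Representation k G M) {X : Type*} [Fintype X]
    [MulAction G X] (b : X → M) (g : G) (hb : ∀ c, b (g • c) = ρ g (b c)) :
    ρ g (∑ c, b c) = ∑ c, b c := by
  rw [map_sum]
  simp only [← hb]
  exact Equiv.sum_comp (MulAction.toPerm g) b

/-- Transfer: an invariant element that is the boundary of an element fixed by a subgroup of
invertible index is the boundary of an invariant element. -/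
theorem exists_invariant_of_index_ne_zero (ρ : Representation k G M) (ρ' : Representation k G M')
    (d : M' →ₗ[k] M) (hd : ∀ g x, d (ρ' g x) = ρ g (d x)) (V : Subgroup G) [V.FiniteIndex]
    (hV : (V.index : k) ≠ 0) (x : M') (hx : ∀ v ∈ V, ρ' v x = x)
    (hdx : ∀ g, ρ g (d x) = d x) :
    ∃ y : M', (∀ g, ρ' g y = y) ∧ d y = d x := by
  have : Fintype (G ⧸ V) := V.fintypeQuotientOfFiniteIndex
  -- The average of the translates of `x`. Each translate still has boundary `d x`, since `d x` is
  -- invariant.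
  refine ⟨(V.index : k)⁻¹ • ∑ c, cosetOrbit ρ' V x hx c, fun g => ?_, ?_⟩
  · rw [map_smul, apply_sum_of_equivariant _ _ _ fun c => cosetOrbit_smul ρ' V x hx g c]
  · have h : ∀ c, d (cosetOrbit ρ' V x hx c) = d x := fun c => by
      induction c using QuotientGroup.induction_on with
      | H a => rw [cosetOrbit_mk, hd, hdx]
    rw [map_smul, map_sum, Finset.sum_congr rfl fun c _ => h c, Finset.sum_const,
      Finset.card_univ, ← Nat.card_eq_fintype_card, ← Subgroup.index, ← Nat.cast_smul_eq_nsmul k,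
      smul_smul, inv_mul_cancel₀ hV, one_smul]

/-- Stable elements: for an abelian Sylow subgroup `V`, an element fixed by `V` whose class modulo
boundaries is fixed by the normalizer of `V` is congruent to an invariant element, provided that
elements centralizing a subgroup `Q` act trivially on classes of `Q`-invariant elements. -/
theorem exists_invariant_sub_mem_boundaries {p : ℕ} [Fact p.Prime] [Finite G]
    (ρ : Representation k G M) (ρ' : Representation k G M')
    (d : M' →ₗ[k] M) (hd : ∀ g x, d (ρ' g x) = ρ g (d x))
    (V : Sylow p G) (hV : ∀ x ∈ (V : Subgroup G), ∀ y ∈ (V : Subgroup G), x * y = y * x)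
    (hind : ((V : Subgroup G).index : k) ≠ 0) (f : M)
    (hf : ∀ v ∈ (V : Subgroup G), ρ v f = f)
    (hT : ∀ (Q : Subgroup G) (c : G), Q ≤ V → (∀ q ∈ Q, c * q = q * c) →
      ∃ b : M', (∀ q ∈ Q, ρ' q b = b) ∧ d b = ρ c f - f)
    (hN : ∀ n ∈ Subgroup.normalizer ((V : Subgroup G) : Set G),
      ∃ b : M', (∀ v ∈ (V : Subgroup G), ρ' v b = b) ∧ d b = ρ n f - f) :
    ∃ y : M, (∀ g, ρ g y = y) ∧
      ∃ b : M', (∀ v ∈ (V : Subgroup G), ρ' v b = b) ∧ d b = y - f := by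
  have : Fintype (G ⧸ (V : Subgroup G)) := Fintype.ofFinite _
  let F := cosetOrbit ρ (V : Subgroup G) f hf
  -- A primitive of `g f - f` is chosen for each coset `gV`, equivariantly under `V`. This requires
  -- a primitive fixed by the stabilizer of `gV` in `V`, namely `V ∩ gVg⁻¹`.
  obtain ⟨b, hb, hb'⟩ := exists_equivariant_choice (Γ := (V : Subgroup G))
    (X := G ⧸ (V : Subgroup G)) (fun v c => (v : G) • c) (fun v m => ρ' v m)
    (fun c => one_smul G c) (fun g h c => mul_smul (g : G) h c)
    (fun g h m => by rw [Subgroup.coe_mul, map_mul, Module.End.mul_apply])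
    (fun c b => d b = F c - f)
    (fun v c b h => by
      rw [hd, h, map_sub, hf _ v.2, ← cosetOrbit_smul])
    (fun c => by
      induction c using QuotientGroup.induction_on with
      | H g =>
        obtain ⟨c, hc, hn⟩ := exists_centralizing_mul_mem_normalizer V hV g
        obtain ⟨b, hb, hdb⟩ := hN _ hn
        let Q : Subgroup G := (V : Subgroup G) ⊓ (V : Subgroup G).map (MulAut.conj g).toMonoidHom
        have hQ : ∀ q, q ∈ Q ↔ q ∈ (V : Subgroup G) ∧ g⁻¹ * q * g ∈ (V : Subgroup G) := by
          intro q
          refine and_congr Iff.rfl ⟨?_, fun h => ⟨_, h, ?_⟩⟩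
          · rintro ⟨z, hz, rfl⟩
            have : g⁻¹ * (g * z * g⁻¹) * g = z := by group
            exact this.symm ▸ (hz : z ∈ (V : Subgroup G))
          · change g * (g⁻¹ * q * g) * g⁻¹ = q
            group
        have hc' : ∀ q ∈ Q, c⁻¹ * q = q * c⁻¹ := fun q hq => by
          have := hc q ((hQ q).1 hq).1 ((hQ q).1 hq).2
          rw [inv_mul_eq_iff_eq_mul, ← mul_assoc, this, mul_inv_cancel_right]
        obtain ⟨b', hb', hdb'⟩ := hT Q c⁻¹ inf_le_left hc'
        -- From `g f - f = (c⁻¹ f - f) + c⁻¹ ((c * g) f - f)`. The second term stays `Q`-fixed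
        -- because `b` is `V`-fixed and `c⁻¹` commutes with `Q`.
        refine ⟨b' + ρ' c⁻¹ b, ?_, fun v hv => ?_⟩
        · change _ = ρ g f - f
          rw [map_add, hd, hdb, hdb', map_sub, ← Module.End.mul_apply, ← map_mul,
            inv_mul_cancel_left]
          abel
        · have hv' : (v : G) ∈ Q := by
            rw [hQ]
            refine ⟨v.2, ?_⟩
            have := QuotientGroup.eq.1 (hv.symm : ((g : G) : G ⧸ (V : Subgroup G)) =
              (((v : G) * g : G) : G ⧸ (V : Subgroup G)))
            exact mul_assoc g⁻¹ (v : G) g ▸ this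
          rw [map_add, hb' _ hv', ← Module.End.mul_apply, ← map_mul, ← hc' _ hv', map_mul,
            Module.End.mul_apply, hb _ v.2])
  -- The individual `b c` are only permuted by `V`, but their average is `V`-invariant.
  refine ⟨((V : Subgroup G).index : k)⁻¹ • ∑ c, F c, fun g => ?_,
    ((V : Subgroup G).index : k)⁻¹ • ∑ c, b c, fun v hv => ?_, ?_⟩
  · rw [map_smul, apply_sum_of_equivariant _ _ _ fun c => cosetOrbit_smul ρ _ f hf g c]
  · rw [map_smul, apply_sum_of_equivariant _ _ _ fun c => hb' ⟨v, hv⟩ c]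
  · rw [map_smul, map_sum, Finset.sum_congr rfl fun c _ => hb c, Finset.sum_sub_distrib,
      Finset.sum_const, Finset.card_univ, ← Nat.card_eq_fintype_card, ← Subgroup.index,
      ← Nat.cast_smul_eq_nsmul k, smul_sub, smul_smul, inv_mul_cancel₀ hind, one_smul]

end Algebra

/-! ### Centralizing elements act trivially on cohomology -/

section EquivariantHomotopy

variable (R : Type) [CommRing R] {S : SSet.{v}} {G : Type u} [Group G] (a : G →* End S)

theorem cochainPullback_id (n : ℕ) : cochainPullback R (𝟙 S) n = LinearMap.id := rfl

/-- The action on cochains induced by an action on a simplicial set. -/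
def cochainRep (n : ℕ) : Representation R G (Cochain R S n) where
  toFun g := cochainPullback R (a g⁻¹) n
  map_one' := by
    rw [inv_one, map_one]
    rfl
  map_mul' g h := by
    rw [mul_inv_rev, map_mul]
    rfl

theorem cochainRep_apply (n : ℕ) (g : G) (f : Cochain R S n) (σ : S.obj (op (.mk n))) :
    cochainRep R a n g f σ = f ((a g⁻¹).app _ σ) := rfl

theorem coboundary_cochainRep (n : ℕ) (g : G) (f : Cochain R S n) :
    coboundary R S n (cochainRep R a n g f) = cochainRep R a (n + 1) g (coboundary R S n f) :=
  coboundary_cochainPullback R (a g⁻¹) n f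

/-- The coboundary with values in degree `n`, zero when `n = 0`. -/
def coboundaryTo (S : SSet.{v}) : (n : ℕ) → Cochain R S (n - 1) →ₗ[R] Cochain R S n
  | 0 => 0
  | n + 1 => coboundary R S n

theorem mem_coboundaries_iff {S : SSet.{v}} {n : ℕ} {f : Cochain R S n} :
    f ∈ coboundaries R S n ↔ ∃ g, coboundaryTo R S n g = f := by
  cases n with
  | zero =>
    exact ⟨fun h => ⟨0, ((Submodule.mem_bot R).1 h).symm⟩,
      fun ⟨g, h⟩ => (Submodule.mem_bot R).2 h.symm⟩
  | succ n => exact Iff.rfl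

theorem coboundary_coboundaryTo (S : SSet.{v}) (n : ℕ) (f : Cochain R S (n - 1)) :
    coboundary R S n (coboundaryTo R S n f) = 0 := by
  cases n with
  | zero => exact map_zero _
  | succ n => exact coboundary_coboundary R S n f

theorem coboundaryTo_cochainPullback {T : SSet.{v}} (φ : S ⟶ T) (n : ℕ)
    (f : Cochain R T (n - 1)) :
    coboundaryTo R S n (cochainPullback R φ (n - 1) f) =
      cochainPullback R φ n (coboundaryTo R T n f) := by
  cases n with
  | zero => rfl
  | succ n => exact coboundary_cochainPullback R φ n f

theorem coboundaryTo_cochainRep (n : ℕ) (g : G) (f : Cochain R S (n - 1)) :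
    coboundaryTo R S n (cochainRep R a (n - 1) g f) =
      cochainRep R a n g (coboundaryTo R S n f) :=
  coboundaryTo_cochainPullback R (a g⁻¹) n f

/-- A contraction of the cochains of a simplicial set onto the constant cochains. -/
structure CochainContraction (S : SSet.{v}) where
  /-- the contracting homotopy -/
  s (n : ℕ) : Cochain R S (n + 1) →ₗ[R] Cochain R S n
  /-- the value of the constant cochain -/
  e (n : ℕ) : Cochain R S n → R
  s_zero (f : Cochain R S 0) : s 0 (coboundary R S 0 f) = f - fun _ => e 0 f
  s_succ (n : ℕ) (f : Cochain R S (n + 1)) :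
    s (n + 1) (coboundary R S (n + 1) f) + coboundary R S n (s n f) = f - fun _ => e (n + 1) f
  s_const (n : ℕ) (r : R) : ∃ r', s n (fun _ => r) = fun _ => r'

variable {R} (C : CochainContraction R S) (Q : Subgroup G)
  (hfree : ∀ (n : ℕ) (q : G) (σ : S.obj (op (.mk n))), (a q).app _ σ = σ → q = 1)

include hfree in
/-- Extension of an operator along the coboundary, equivariantly for a free action. -/
theorem exists_equivariant_factorization (n : ℕ) (T : Cochain R S n →ₗ[R] Cochain R S n)
    (E : Cochain R S (n + 1) →ₗ[R] Cochain R S n)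
    (hT : ∀ q ∈ Q, ∀ f, T (cochainRep R a n q f) = cochainRep R a n q (T f))
    (hE : ∀ f, E (coboundary R S n f) = T f) (hE' : ∀ r : R, E (fun _ => r) = 0) :
    ∃ K : Cochain R S (n + 1) →ₗ[R] Cochain R S n,
      (∀ q ∈ Q, ∀ f, K (cochainRep R a (n + 1) q f) = cochainRep R a n q (K f)) ∧
      (∀ f, K (coboundary R S n f) = T f) ∧ ∀ r : R, K (fun _ => r) = 0 := by
  have happ : ∀ (g h : G) (m : ℕ) (σ : S.obj (op (.mk m))),
      (a (g * h)).app _ σ = (a g).app _ ((a h).app _ σ) := fun g h m σ => by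
    rw [map_mul]; rfl
  have happ1 : ∀ (m : ℕ) (σ : S.obj (op (.mk m))), (a 1).app _ σ = σ := fun m σ => by
    rw [map_one]; rfl
  -- `E` need not be equivariant, but the conditions on `K` can be imposed one simplex at a time.
  -- Its components on orbit representatives are taken from `E` and spread along the orbits;
  -- freeness leaves no stabilizer condition.
  obtain ⟨b, hb, hb'⟩ := exists_equivariant_choice (Γ := Q) (X := S.obj (op (.mk n)))
    (M := Cochain R S (n + 1) →ₗ[R] R) (fun q σ => (a q).app _ σ)
    (fun q l => l ∘ₗ cochainRep R a (n + 1) (q : G)⁻¹)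
    (happ1 n) (fun g h => happ g h n)
    (fun g h l => by
      rw [LinearMap.comp_assoc, Subgroup.coe_mul, mul_inv_rev, map_mul]
      rfl)
    (fun σ l => (∀ f, l (coboundary R S n f) = T f σ) ∧ ∀ r : R, l (fun _ => r) = 0)
    (fun q σ l h => ⟨fun f => by
        rw [LinearMap.comp_apply, ← coboundary_cochainRep, h.1, hT _ (Q.inv_mem q.2),
          cochainRep_apply, inv_inv], fun r => h.2 r⟩)
    (fun σ => ⟨LinearMap.proj σ ∘ₗ E, ⟨fun f => congrFun (hE f) σ, fun r => congrFun (hE' r) σ⟩,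
      fun q hq => by
        have : (q : G)⁻¹ = 1 := inv_eq_one.2 (hfree n q σ hq)
        rw [this, map_one]
        rfl⟩)
  refine ⟨LinearMap.pi b, fun q hq f => ?_, fun f => funext fun σ => (hb σ).1 f,
    fun r => funext fun σ => (hb σ).2 r⟩
  funext σ
  rw [cochainRep_apply, LinearMap.pi_apply, LinearMap.pi_apply]
  have := hb' ⟨q⁻¹, Q.inv_mem hq⟩ σ
  change b ((a q⁻¹).app _ σ) = b σ ∘ₗ cochainRep R a (n + 1) q⁻¹⁻¹ at this
  rw [this, inv_inv]
  rfl

variable (c : G) (hc : ∀ q ∈ Q, c * q = q * c)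

include C hfree hc in
/-- The `Q`-equivariant homotopy between the identity and the action of an element `c` centralizing
`Q`, by induction on the degree: `K` is the homotopy in degree `n + 1` and `T` is the part of
`c - 1` in degree `n` which it has to account for. -/
theorem exists_equivariant_homotopy (n : ℕ) :
    ∃ (T : Cochain R S n →ₗ[R] Cochain R S n) (K : Cochain R S (n + 1) →ₗ[R] Cochain R S n),
      (∀ f, coboundary R S n (T f) = coboundary R S n (cochainRep R a n c f - f)) ∧
      (∀ q ∈ Q, ∀ f, K (cochainRep R a (n + 1) q f) = cochainRep R a n q (K f)) ∧
      (∀ f, K (coboundary R S n f) = T f) ∧ (∀ r : R, K (fun _ => r) = 0) ∧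
      (∀ f, (∀ q ∈ Q, cochainRep R a n q f = f) → ∃ b,
        (∀ q ∈ Q, cochainRep R a (n - 1) q b = b) ∧
        T f = cochainRep R a n c f - f - coboundaryTo R S n b) := by
  have hcc : ∀ (m : ℕ), ∀ q ∈ Q, ∀ f, cochainRep R a m c (cochainRep R a m q f) =
      cochainRep R a m q (cochainRep R a m c f) := fun m q hq f => by
    rw [← Module.End.mul_apply, ← map_mul, hc q hq, map_mul, Module.End.mul_apply]
  induction n with
  | zero =>
    let T : Cochain R S 0 →ₗ[R] Cochain R S 0 := cochainRep R a 0 c - LinearMap.id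
    have hT : ∀ f, T f = cochainRep R a 0 c f - f := fun f => rfl
    have hconst : ∀ r : R, T (fun _ => r) = 0 := fun r => by
      rw [hT]
      exact sub_self _
    -- The operator `T ∘ s` extends `T` along the coboundary: `s d` is the identity up to constant
    -- cochains, which `T` kills.
    obtain ⟨K, h1, h2, h3⟩ := exists_equivariant_factorization a Q hfree 0 T (T ∘ₗ C.s 0)
      (fun q hq f => by rw [hT, hT, hcc 0 q hq, map_sub])
      (fun f => by rw [LinearMap.comp_apply, C.s_zero, map_sub, hconst, sub_zero])
      (fun r => by
        obtain ⟨r', h⟩ := C.s_const 0 r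
        rw [LinearMap.comp_apply, h, hconst])
    refine ⟨T, K, fun f => rfl, h1, h2, h3, fun f _ => ⟨0, fun q _ => map_zero _, ?_⟩⟩
    rw [map_zero, sub_zero, hT]
  | succ n ih =>
    obtain ⟨T', K', h0', h1', h2', h3', -⟩ := ih
    let T : Cochain R S (n + 1) →ₗ[R] Cochain R S (n + 1) :=
      cochainRep R a (n + 1) c - LinearMap.id - coboundary R S n ∘ₗ K'
    have hT : ∀ f, T f = cochainRep R a (n + 1) c f - f - coboundary R S n (K' f) := fun f => rfl
    have hconst : ∀ r : R, T (fun _ => r) = 0 := fun r => by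
      rw [hT, h3', map_zero, sub_zero]
      exact sub_self _
    -- With `T' = K' d` and `d T' = d (c - 1)`, the correction `d K'` cancels `c - 1` on
    -- coboundaries. So the term `d s` in the contraction formula does not contribute to `T ∘ s ∘
    -- d`.
    have hd : ∀ f, T (coboundary R S n f) = 0 := fun f => by
      rw [hT, h2', h0', map_sub, coboundary_cochainRep, sub_self]
    obtain ⟨K, h1, h2, h3⟩ := exists_equivariant_factorization a Q hfree (n + 1) T
      (T ∘ₗ C.s (n + 1))
      (fun q hq f => by
        rw [hT, hT, hcc _ q hq, map_sub, map_sub, h1' q hq, coboundary_cochainRep])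
      (fun f => by
        rw [LinearMap.comp_apply, eq_sub_of_add_eq (C.s_succ n f), map_sub, map_sub, hconst, hd,
          sub_zero, sub_zero])
      (fun r => by
        obtain ⟨r', h⟩ := C.s_const (n + 1) r
        rw [LinearMap.comp_apply, h, hconst])
    refine ⟨T, K, fun f => ?_, h1, h2, h3, fun f hf => ⟨K' f, fun q hq => ?_, hT f⟩⟩
    · rw [hT, map_sub _ (_ - _), coboundary_coboundary, sub_zero]
    · change cochainRep R a n q (K' f) = K' f
      rw [← h1' q hq, hf q hq]

include C hfree hc in
/-- An element centralizing `Q` acts trivially on the cohomology of the `Q`-invariant cochains. -/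
theorem exists_invariant_coboundaryTo_eq (n : ℕ) (f : Cochain R S n)
    (hf : coboundary R S n f = 0) (hQ : ∀ q ∈ Q, cochainRep R a n q f = f) :
    ∃ b, (∀ q ∈ Q, cochainRep R a (n - 1) q b = b) ∧
      coboundaryTo R S n b = cochainRep R a n c f - f := by
  obtain ⟨T, K, -, -, h2, -, h4⟩ := exists_equivariant_homotopy a C Q hfree c hc n
  obtain ⟨b, hb, hb'⟩ := h4 f hQ
  -- On a cocycle `T f = K (d f) = 0`, so `c f - f` is exactly the coboundary of `b`.
  rw [← h2, hf, map_zero] at hb'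
  exact ⟨b, hb, (sub_eq_zero.1 hb'.symm).symm⟩

end EquivariantHomotopy

/-! ### Homology and cohomology over a field -/

section Duality

variable (k : Type) [Field k]

/-- The field `k` as an object of `ModuleCat.{v} k`. -/
abbrev coefficients : ModuleCat.{v} k := ModuleCat.of k (ULift.{v} k)

theorem coefficients_injective : Injective (coefficients.{v} k) :=
  have : Module.Injective k (ULift.{v} k) := Module.injective_of_isSemisimpleRing k _
  Module.injective_object_of_injective_module k (ULift.{v} k)

variable {k}

/-- Functionals separate the points of a vector space. If each one on `X` factors through `g`, an
element killed by `g` is killed by all of them. -/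
theorem mono_of_forall_exists_comp_eq {X Y : ModuleCat.{v} k} (g : X ⟶ Y)
    (h : ∀ l : X ⟶ coefficients k, ∃ l' : Y ⟶ coefficients k, g ≫ l' = l) : Mono g := by
  rw [ModuleCat.mono_iff_injective, injective_iff_map_eq_zero]
  intro x hx
  rw [← Module.forall_dual_apply_eq_zero_iff k]
  intro f
  obtain ⟨l', hl'⟩ := h (ModuleCat.ofHom (ULift.moduleEquiv.symm.toLinearMap ∘ₗ f))
  have := congrArg (fun l => l x) hl'
  change l' (g x) = ULift.up (f x) at this
  rw [hx, map_zero] at this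
  exact congrArg ULift.down this.symm

/-- A proper subspace, here the range of `g`, lies in the kernel of some nonzero functional. -/
theorem epi_of_forall_eq_zero {X Y : ModuleCat.{v} k} (g : X ⟶ Y)
    (h : ∀ l : Y ⟶ coefficients k, g ≫ l = 0 → l = 0) : Epi g := by
  rw [ModuleCat.epi_iff_range_eq_top]
  by_contra hne
  obtain ⟨f, hf, hle⟩ := Submodule.exists_le_ker_of_lt_top _ (lt_top_iff_ne_top.2 hne)
  have := h (ModuleCat.ofHom (ULift.moduleEquiv.symm.toLinearMap ∘ₗ f)) (by
    ext x
    exact hle ⟨x, rfl⟩)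
  refine hf (LinearMap.ext fun y => ?_)
  exact congrArg (fun l => ULift.down (l y)) this

variable {ι : Type*} {c : ComplexShape ι} {K L : HomologicalComplex (ModuleCat.{v} k) c}

/-- Over a field, a chain map inducing an isomorphism in cohomology, computed by maps to the
field, induces an isomorphism in homology. -/
theorem isIso_homologyMap_of_dual (F : K ⟶ L) (n : ι)
    (surj : ∀ φ : K.X n ⟶ coefficients k, K.d (c.prev n) n ≫ φ = 0 →
      ∃ ψ : L.X n ⟶ coefficients k, L.d (c.prev n) n ≫ ψ = 0 ∧
        ∃ η : K.X (c.next n) ⟶ coefficients k, F.f n ≫ ψ - φ = K.d n (c.next n) ≫ η)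
    (inj : ∀ ψ : L.X n ⟶ coefficients k, L.d (c.prev n) n ≫ ψ = 0 →
      ∀ η : K.X (c.next n) ⟶ coefficients k, F.f n ≫ ψ = K.d n (c.next n) ≫ η →
        ∃ η' : L.X (c.next n) ⟶ coefficients k, ψ = L.d n (c.next n) ≫ η') :
    IsIso (HomologicalComplex.homologyMap F n) := by
  have := coefficients_injective.{v} k
  have hmono : Mono (HomologicalComplex.homologyMap F n) := by
    refine mono_of_forall_exists_comp_eq _ fun l => ?_
    -- Homology embeds in the opcycles, the chains modulo boundaries. Extending `l` to them yields a
    -- functional on chains that vanishes on boundaries, that is, a cocycle.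
    let l₁ := Injective.factorThru l (K.homologyι n)
    have hl₁ : K.homologyι n ≫ l₁ = l := Injective.comp_factorThru _ _
    obtain ⟨ψ, hψ, η, hη⟩ := surj (K.pOpcycles n ≫ l₁) (by simp)
    refine ⟨L.homologyι n ≫ L.descOpcycles ψ _ rfl hψ, ?_⟩
    have h := K.homologyι_descOpcycles_eq_zero_of_boundary _ _ rfl η hη
    have h' : K.descOpcycles (F.f n ≫ ψ - K.pOpcycles n ≫ l₁) _ rfl
        (by rw [hη, K.d_comp_d_assoc, Limits.zero_comp]) =
        HomologicalComplex.opcyclesMap F n ≫ L.descOpcycles ψ _ rfl hψ - l₁ := by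
      rw [← cancel_epi (K.pOpcycles n)]
      simp
    rw [h', Preadditive.comp_sub, sub_eq_zero, hl₁] at h
    rw [HomologicalComplex.homologyι_naturality_assoc, h]
  have hepi : Epi (HomologicalComplex.homologyMap F n) := by
    refine epi_of_forall_eq_zero _ fun l hl => ?_
    let l₁ := Injective.factorThru l (L.homologyι n)
    have hl₁ : L.homologyι n ≫ l₁ = l := Injective.comp_factorThru _ _
    -- Homology is the kernel of the differential on opcycles, so a functional vanishing on it
    -- factors through that differential, by injectivity of the coefficients. This exhibits the
    -- pulled back cocycle as a coboundary.
    have hex : (ShortComplex.mk _ _ (K.homologyι_comp_fromOpcycles n (c.next n))).Exact :=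
      ShortComplex.exact_of_f_is_kernel _ (K.homologyIsKernel n _ rfl)
    have h0 : K.homologyι n ≫ HomologicalComplex.opcyclesMap F n ≫ l₁ = 0 := by
      rw [← HomologicalComplex.homologyι_naturality_assoc, hl₁, hl]
    have h1 := hex.comp_descToInjective _ h0
    obtain ⟨η', hη'⟩ := inj (L.pOpcycles n ≫ l₁) (by simp) (hex.descToInjective _ h0) (by
      rw [← HomologicalComplex.p_opcyclesMap_assoc, ← K.p_fromOpcycles, Category.assoc]
      exact congrArg _ h1.symm)
    have h2 : l₁ = L.fromOpcycles n (c.next n) ≫ η' := by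
      rw [← cancel_epi (L.pOpcycles n), hη']
      simp
    rw [← hl₁, h2, HomologicalComplex.homologyι_comp_fromOpcycles_assoc, Limits.zero_comp]
  exact isIso_of_mono_of_epi _

end Duality

/-! ### Cochains as functionals on chains -/

section ChainCochain

variable (k : Type) [Field k] (S : SSet.{v})

/-- The chain complex of a simplicial set with coefficients in the field `k`. -/
abbrev chains : ChainComplex (ModuleCat.{v} k) ℕ := S.chainComplex (coefficients k)

variable {S}

/-- The map from chains to `k` given by a cochain. -/
def cochainHom (n : ℕ) (f : Cochain k S n) : (chains k S).X n ⟶ coefficients k :=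
  Limits.Cofan.IsColimit.desc (S.isColimitChainComplexXCofan (coefficients k) n)
    fun σ => f σ • 𝟙 (coefficients k)

variable {k}

theorem ι_cochainHom {n : ℕ} (f : Cochain k S n) (σ : S.obj (op (.mk n))) :
    S.ιChainComplex σ ≫ cochainHom k n f = f σ • 𝟙 (coefficients k) :=
  Limits.Cofan.IsColimit.fac (S.isColimitChainComplexXCofan (coefficients k) n) _ σ

variable (k) in
/-- The endomorphisms of the field `k` are the scalars. -/
theorem exists_smul_id (φ : coefficients.{v} k ⟶ coefficients k) :
    φ = (φ (ULift.up 1)).down • 𝟙 (coefficients k) := by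
  refine ModuleCat.hom_ext (LinearMap.ext fun ⟨x⟩ => ?_)
  have hx : (ULift.up x : ULift.{v} k) = x • ULift.up 1 := ULift.ext _ _ (mul_one x).symm
  rw [hx, map_smul, map_smul]
  exact congrArg _ (ULift.ext _ _ (mul_one _).symm)

theorem smul_id_injective {a b : k}
    (h : a • 𝟙 (coefficients.{v} k) = b • 𝟙 (coefficients k)) : a = b := by
  have := congrArg (fun φ => (φ (ULift.up 1)).down) h
  change a * 1 = b * 1 at this
  simpa using this

theorem cochainHom_injective {n : ℕ} {f g : Cochain k S n}
    (h : cochainHom k n f = cochainHom k n g) : f = g := by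
  funext σ
  apply smul_id_injective.{v}
  rw [← ι_cochainHom, h, ι_cochainHom]

theorem cochainHom_surjective {n : ℕ} (φ : (chains k S).X n ⟶ coefficients k) :
    ∃ f, cochainHom k n f = φ :=
  ⟨fun σ => ((S.ιChainComplex σ ≫ φ) (ULift.up 1)).down, SSet.chainComplex_hom_ext fun σ => by
    rw [ι_cochainHom, ← exists_smul_id]⟩

theorem cochainHom_add {n : ℕ} (f g : Cochain k S n) :
    cochainHom k n (f + g) = cochainHom k n f + cochainHom k n g :=
  SSet.chainComplex_hom_ext fun σ => by
    rw [Preadditive.comp_add, ι_cochainHom, ι_cochainHom, ι_cochainHom, Pi.add_apply, add_smul]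

theorem cochainHom_smul {n : ℕ} (r : k) (f : Cochain k S n) :
    cochainHom k n (r • f) = r • cochainHom k n f :=
  SSet.chainComplex_hom_ext fun σ => by
    rw [Linear.comp_smul, ι_cochainHom, ι_cochainHom, Pi.smul_apply, smul_assoc]

variable (k S) in
/-- Cochains are the maps from chains to the field. -/
def cochainEquiv (n : ℕ) : Cochain k S n ≃ₗ[k] ((chains k S).X n ⟶ coefficients k) :=
  LinearEquiv.ofBijective
    { toFun := cochainHom k n
      map_add' := cochainHom_add
      map_smul' := cochainHom_smul }
    ⟨fun _ _ => cochainHom_injective, cochainHom_surjective⟩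

theorem cochainEquiv_apply {n : ℕ} (f : Cochain k S n) :
    cochainEquiv k S n f = cochainHom k n f := rfl

/-- Reconciles the integer signs of the chain differential with the signs in `k` of `coboundary`. -/
theorem neg_one_pow_zsmul {M : Type*} [AddCommGroup M] [Module k M] (i : ℕ) (m : M) :
    ((-1 : ℤ) ^ i) • m = ((-1 : k) ^ i) • m := by
  rw [← Int.cast_smul_eq_zsmul k]
  push_cast
  rfl

theorem d_cochainHom {n : ℕ} (f : Cochain k S n) :
    (chains k S).d (n + 1) n ≫ cochainHom k n f = cochainHom k (n + 1) (coboundary k S n f) := by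
  refine SSet.chainComplex_hom_ext fun σ => ?_
  rw [SSet.ιChainComplex_d_assoc, ι_cochainHom, Preadditive.sum_comp]
  simp only [Preadditive.zsmul_comp, ι_cochainHom]
  simp only [neg_one_pow_zsmul (k := k), smul_smul]
  rw [← Finset.sum_smul]
  rfl

theorem map_cochainHom {T : SSet.{v}} (φ : S ⟶ T) {n : ℕ} (f : Cochain k T n) :
    (SSet.chainComplexMap φ (coefficients k)).f n ≫ cochainHom k n f =
      cochainHom k n (cochainPullback k φ n f) := by
  refine SSet.chainComplex_hom_ext fun σ => ?_
  rw [SSet.ι_chainComplexMap_f_assoc, ι_cochainHom, ι_cochainHom]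
  rfl

/-- A map of simplicial sets inducing an isomorphism in cohomology with coefficients in a field
induces an isomorphism in homology. -/
theorem isIso_homologyMap_of_bijective_pullback {T : SSet.{v}} (φ : S ⟶ T) (n : ℕ)
    (h : Function.Bijective (pullback k φ n)) :
    IsIso (HomologicalComplex.homologyMap (SSet.chainComplexMap φ (coefficients.{v} k)) n) := by
  have hprev : (ComplexShape.down ℕ).prev n = n + 1 := ChainComplex.prev ℕ n
  have hcocycle : ∀ {U : SSet.{v}} (f : Cochain k U n),
      (chains k U).d ((ComplexShape.down ℕ).prev n) n ≫ cochainHom k n f = 0 ↔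
        coboundary k U n f = 0 := fun {U} f => by
    rw [hprev, d_cochainHom, ← cochainEquiv_apply, map_eq_zero_iff _ (LinearEquiv.injective _)]
  have hcobound : ∀ {U : SSet.{v}} (f : Cochain k U n),
      (∃ η, cochainHom k n f = (chains k U).d n ((ComplexShape.down ℕ).next n) ≫ η) ↔
        f ∈ coboundaries k U n := fun {U} f => by
    cases n with
    | zero =>
      -- The differential leaving degree `0` vanishes, matching the convention that `coboundaries`
      -- is `⊥` there.
      rw [HomologicalComplex.shape _ _ _ (by rw [ChainComplex.next_nat_zero]; simp)]
      simp only [Limits.zero_comp, exists_const]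
      rw [← cochainEquiv_apply, map_eq_zero_iff _ (LinearEquiv.injective _)]
      rfl
    | succ n =>
      have hnext : (ComplexShape.down ℕ).next (n + 1) = n := ChainComplex.next_nat_succ n
      rw [hnext]
      constructor
      · rintro ⟨η, hη⟩
        obtain ⟨g, rfl⟩ := cochainHom_surjective η
        rw [d_cochainHom] at hη
        exact ⟨g, (cochainHom_injective hη).symm⟩
      · rintro ⟨g, rfl⟩
        exact ⟨cochainHom k n g, (d_cochainHom g).symm⟩
  have hmem : ∀ {U : SSet.{v}} (f : cocycles k U n),
      (Submodule.Quotient.mk f : Cohomology k U n) = 0 ↔ f.1 ∈ coboundaries k U n := fun f =>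
    Submodule.Quotient.mk_eq_zero _
  refine isIso_homologyMap_of_dual _ n (fun α hα => ?_) (fun β hβ η hη => ?_)
  · obtain ⟨f, rfl⟩ := cochainHom_surjective (k := k) (S := S) α
    obtain ⟨y, hy⟩ := h.2 (Submodule.Quotient.mk ⟨f, (hcocycle f).1 hα⟩)
    induction y using Submodule.Quotient.induction_on with
    | H g =>
      refine ⟨cochainHom k n g.1, (hcocycle g.1).2 g.2, ?_⟩
      have h1 : cochainPullback k φ n g.1 - f ∈ coboundaries k S n :=

        (Submodule.Quotient.eq ((coboundaries k S n).comap (cocycles k S n).subtype)).1 hy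
      obtain ⟨η, hη⟩ := (hcobound _).2 h1
      refine ⟨η, ?_⟩
      rw [map_cochainHom, ← hη]
      exact (map_sub (cochainEquiv k S n) _ _).symm
  · obtain ⟨g, rfl⟩ := cochainHom_surjective (k := k) (S := T) β
    rw [map_cochainHom] at hη
    refine (hcobound g).2 ?_
    rw [← hmem ⟨g, (hcocycle g).1 hβ⟩]
    apply h.1
    rw [map_zero]
    exact (hmem _).2 ((hcobound _).1 ⟨η, hη⟩)

/-- A simplicial homotopy from the identity to a map which is constant in each degree contracts
the cochains. -/
def CochainContraction.ofHomotopy {c : S ⟶ S} (H : SimplicialObject.Homotopy (𝟙 S) c)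
    (x : ∀ n, S.obj (op (.mk n))) (hc : ∀ n σ, c.app (op (.mk n)) σ = x n) :
    CochainContraction k S :=
  let h := H.sSetChainComplexMap (coefficients.{v} k)
  have hs : ∀ (n : ℕ) (f : Cochain k S (n + 1)), cochainHom k n
      ((cochainEquiv k S n).symm (h.hom n (n + 1) ≫ cochainHom k (n + 1) f)) =
      h.hom n (n + 1) ≫ cochainHom k (n + 1) f := fun n f =>
    (cochainEquiv k S n).apply_symm_apply _
  have hcst : ∀ (n : ℕ) (f : Cochain k S n), cochainPullback k c n f = fun _ => f (x n) :=
    fun n f => funext fun σ => congrArg f (hc n σ)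
  { s := fun n => (cochainEquiv k S n).symm.toLinearMap ∘ₗ
      Linear.leftComp k (coefficients k) (h.hom n (n + 1)) ∘ₗ (cochainEquiv k S (n + 1)).toLinearMap
    e := fun n f => f (x n)
    s_zero := fun f => by
      rw [← hcst, eq_sub_iff_add_eq]
      apply cochainHom_injective
      have h1 := h.comm 0 =≫ cochainHom k 0 f
      rw [Homotopy.dNext_zero_chainComplex, Homotopy.prevD_chainComplex, zero_add,
        Preadditive.add_comp, map_cochainHom, map_cochainHom,
        cochainPullback_id, LinearMap.id_apply, Category.assoc, d_cochainHom] at h1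
      rw [cochainHom_add, h1]
      congr 1
      exact hs 0 _
    s_succ := fun n f => by
      rw [← hcst, eq_sub_iff_add_eq]
      apply cochainHom_injective
      have h1 := h.comm (n + 1) =≫ cochainHom k (n + 1) f
      rw [Homotopy.dNext_succ_chainComplex, Homotopy.prevD_chainComplex,
        Preadditive.add_comp, Preadditive.add_comp, map_cochainHom, map_cochainHom,
        cochainPullback_id, LinearMap.id_apply, Category.assoc,
        Category.assoc, d_cochainHom] at h1
      rw [cochainHom_add, cochainHom_add, h1, ← d_cochainHom, add_comm (_ ≫ _)]
      congr 2
      · exact hs (n + 1) _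
      · exact congrArg _ (hs n _)
    s_const := fun n r => ⟨-∑ i : Fin (n + 1), (-1) ^ (i : ℕ) * r, by
      apply cochainHom_injective
      refine (hs n _).trans (SSet.chainComplex_hom_ext fun σ => ?_)
      -- The homotopy sends every simplex to the same signed number of simplices, so its transpose
      -- preserves constant cochains.
      have h1 : S.ιChainComplex σ ≫ h.hom n (n + 1) =
          -∑ i : Fin (n + 1), ((-1 : ℤ) ^ (i : ℕ)) •
            S.ιChainComplex (R := coefficients.{v} k) (H.h i σ) := by
        refine (congrArg _ (SimplicialObject.Homotopy.ToChainHomotopy.hom_eq _ n)).trans ?_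
        rw [Preadditive.comp_neg, Preadditive.comp_sum]
        congr 1
        refine Finset.sum_congr rfl fun i _ => ?_
        rw [Preadditive.comp_zsmul]
        congr 1
        exact (Limits.Sigma.ι_comp_map' (H.h i) _ σ).trans (Category.id_comp _)
      rw [reassoc_of% h1, ι_cochainHom, Preadditive.neg_comp, Preadditive.sum_comp]
      simp only [Preadditive.zsmul_comp, ι_cochainHom]
      simp only [neg_one_pow_zsmul (k := k), smul_smul]
      rw [← Finset.sum_smul, neg_smul]⟩ }

end ChainCochain

/-! ### Lifting simplices to `EG` -/

section Lifting

/-- Maps from a contractible space lift along surjective covering maps. -/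
theorem _root_.IsCoveringMap.exists_lift_of_contractible {A E X : Type*} [TopologicalSpace A]
    [TopologicalSpace E] [TopologicalSpace X] [ContractibleSpace A] {p : E → X}
    (cov : IsCoveringMap p) (hp : Function.Surjective p) (f : C(A, X)) :
    ∃ F : C(A, E), ∀ a, p (F a) = f a := by
  obtain ⟨a₀, ⟨h⟩⟩ := id_nullhomotopic A
  obtain ⟨e₀, he₀⟩ := hp (f a₀)
  -- The contraction run backwards, from the constant map to `f`. Its lift starts at the constant
  -- `e₀` and is evaluated at time `1`.
  let H : C(unitInterval × A, X) := f.comp h.symm.toContinuousMap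
  have H_0 : ∀ a, H (0, a) = p (ContinuousMap.const A e₀ a) := fun a => by
    rw [ContinuousMap.const_apply, he₀]
    exact congrArg f (h.symm.apply_zero a)
  refine ⟨(cov.liftHomotopy H (ContinuousMap.const A e₀) H_0).comp
    ((ContinuousMap.const A 1).prodMk (ContinuousMap.id A)), fun a => ?_⟩
  refine (congrFun (cov.liftHomotopy_lifts H (ContinuousMap.const A e₀) H_0) (1, a)).trans ?_
  exact congrArg f (h.symm.apply_one a)

/-- Singular simplices as continuous maps from the standard simplex. -/
def simplexEquiv (X : Type v) [TopologicalSpace X] (n : ℕ) :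
    (Sing X).obj (op (.mk n)) ≃ C(stdSimplex ℝ (Fin (n + 1)), X) :=
  TopCat.toSSetObjEquiv (TopCat.of X) (op (.mk n))

instance (n : ℕ) : ContractibleSpace (stdSimplex ℝ (Fin (n + 1))) :=
  (convex_stdSimplex ℝ (Fin (n + 1))).contractibleSpace ⟨_, single_mem_stdSimplex ℝ 0⟩

variable (Γ : Type u) [Group Γ] (E : Type v) [TopologicalSpace E] [MulAction Γ E]

/-- The projection `EG → BG`. -/
def classifyingProj : C(E, ClassifyingSpace Γ E) := ⟨Quotient.mk _, continuous_quotient_mk'⟩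

/-- The map induced on singular simplicial sets by the projection `EG → BG`. -/
abbrev singProj : Sing E ⟶ Sing (ClassifyingSpace Γ E) :=
  TopCat.toSSet.map (TopCat.ofHom (classifyingProj Γ E))

variable [ContinuousConstSMul Γ E]

/-- The action on the singular simplicial set. -/
def singAction : Γ →* End (Sing E) where
  toFun g := TopCat.toSSet.map (TopCat.ofHom ⟨fun x => g • x, continuous_const_smul g⟩)
  map_one' := by
    refine Eq.trans ?_ (TopCat.toSSet.map_id _)
    congr 1
    ext x
    exact one_smul Γ x
  map_mul' g h := by
    refine Eq.trans ?_ (TopCat.toSSet.map_comp _ _)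
    congr 1
    ext x
    exact mul_smul g h x

theorem simplexEquiv_singAction (g : Γ) (n : ℕ) (σ : (Sing E).obj (op (.mk n)))
    (x : stdSimplex ℝ (Fin (n + 1))) :
    simplexEquiv E n ((singAction Γ E g).app _ σ) x = g • simplexEquiv E n σ x := rfl

theorem singProj_singAction (g : Γ) (n : ℕ) (σ : (Sing E).obj (op (.mk n))) :
    (singProj Γ E).app _ ((singAction Γ E g).app _ σ) = (singProj Γ E).app _ σ := by
  apply (simplexEquiv _ n).injective
  ext x
  exact Quotient.sound ⟨g, rfl⟩

variable {Γ E} (hE : IsUniversalSpace Γ E)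
include hE

theorem IsUniversalSpace.isQuotientCoveringMap :
    IsQuotientCoveringMap (classifyingProj Γ E) Γ where
  toIsQuotientMap := isQuotientMap_quotient_mk'
  apply_eq_iff_mem_orbit := Quotient.eq''
  disjoint := hE.free

theorem IsUniversalSpace.singAction_free (n : ℕ) (g : Γ) (σ : (Sing E).obj (op (.mk n)))
    (h : (singAction Γ E g).app _ σ = σ) : g = 1 := by
  let x : stdSimplex ℝ (Fin (n + 1)) := Classical.arbitrary _
  have hx : g • simplexEquiv E n σ x = simplexEquiv E n σ x := by
    rw [← simplexEquiv_singAction, h]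
  obtain ⟨U, hU, hU'⟩ := hE.free (simplexEquiv E n σ x)
  exact hU' g ⟨_, ⟨_, mem_of_mem_nhds hU, hx⟩, mem_of_mem_nhds hU⟩

theorem IsUniversalSpace.singProj_surjective (n : ℕ) :
    Function.Surjective ((singProj Γ E).app (op (.mk n))) := fun τ => by
  have cov := hE.isQuotientCoveringMap
  obtain ⟨F, hF⟩ := cov.isCoveringMap.exists_lift_of_contractible cov.surjective
    (simplexEquiv _ n τ)
  refine ⟨(simplexEquiv E n).symm F, (simplexEquiv _ n).injective ?_⟩
  ext x
  exact hF x

/-- Some `g` matches the two lifts at one point of the standard simplex. As the simplex is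
connected, uniqueness of lifts along a covering makes them agree everywhere. -/
theorem IsUniversalSpace.exists_singAction_eq (n : ℕ) (σ τ : (Sing E).obj (op (.mk n)))
    (h : (singProj Γ E).app _ σ = (singProj Γ E).app _ τ) :
    ∃ g, (singAction Γ E g).app _ τ = σ := by
  have cov := hE.isQuotientCoveringMap
  have h' : ∀ x, classifyingProj Γ E (simplexEquiv E n σ x) =
      classifyingProj Γ E (simplexEquiv E n τ x) := fun x =>
    congrArg (fun ρ => simplexEquiv _ n ρ x) h
  let x : stdSimplex ℝ (Fin (n + 1)) := Classical.arbitrary _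
  obtain ⟨g, hg⟩ := cov.apply_eq_iff_mem_orbit.1 (h' x)
  refine ⟨g, (simplexEquiv E n).injective (DFunLike.coe_injective ?_)⟩
  refine cov.isCoveringMap.eq_of_comp_eq (ContinuousMap.continuous _) (ContinuousMap.continuous _)
    (funext fun y => ?_) x hg
  exact (cov.map_smul g).trans (h' y).symm

variable (R : Type) [CommRing R]

theorem IsUniversalSpace.cochainPullback_singProj_injective (n : ℕ) :
    Function.Injective (cochainPullback R (singProj Γ E) n) := fun f g h => by
  funext τ
  obtain ⟨σ, rfl⟩ := hE.singProj_surjective n τ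
  exact congrFun h σ

omit hE in
theorem cochainRep_cochainPullback_singProj (n : ℕ) (g : Γ)
    (f : Cochain R (Sing (ClassifyingSpace Γ E)) n) :
    cochainRep R (singAction Γ E) n g (cochainPullback R (singProj Γ E) n f) =
      cochainPullback R (singProj Γ E) n f :=
  funext fun σ => congrArg f (singProj_singAction Γ E g⁻¹ n σ)

/-- Cochains on `BG` are the invariant cochains on `EG`. -/
theorem IsUniversalSpace.exists_cochainPullback_singProj_eq (n : ℕ) (f : Cochain R (Sing E) n)
    (hf : ∀ g, cochainRep R (singAction Γ E) n g f = f) :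
    ∃ f', cochainPullback R (singProj Γ E) n f' = f := by
  choose l hl using hE.singProj_surjective n
  -- Two lifts of a simplex differ by a group element, so invariance of `f` makes the choice of `l`
  -- irrelevant.
  refine ⟨fun τ => f (l τ), funext fun σ => ?_⟩
  obtain ⟨g, hg⟩ := hE.exists_singAction_eq n _ _ (hl ((singProj Γ E).app _ σ))
  change f (l _) = f σ
  rw [← hg]
  have := congrFun (hf g⁻¹) σ
  rwa [cochainRep_apply, inv_inv] at this

omit hE in
/-- The singular cochains of a contractible space contract onto the constant cochains. -/
theorem nonempty_cochainContraction (k : Type) [Field k] (X : Type v) [TopologicalSpace X]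
    [ContractibleSpace X] : Nonempty (CochainContraction k (Sing X)) := by
  obtain ⟨x₀, ⟨h⟩⟩ := id_nullhomotopic X
  let H : TopCat.Homotopy (𝟙 (TopCat.of X)) (TopCat.ofHom (ContinuousMap.const X x₀)) := h
  have H' := H.toSSet.toSimplicialObjectHomotopy
  rw [TopCat.toSSet.map_id] at H'
  exact ⟨.ofHomotopy H' (fun n => (simplexEquiv X n).symm (ContinuousMap.const _ x₀))
    fun n σ => rfl⟩

end Lifting

/-! ### Restriction to the Sylow subgroup and its normalizer -/

section Restriction

variable {G : Type u} [Group G] {E : Type v} [TopologicalSpace E] [MulAction G E]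
  [ContinuousConstSMul G E]

instance continuousConstSMul_subgroup (H : Subgroup G) : ContinuousConstSMul H E :=
  ⟨fun h => continuous_const_smul (h : G)⟩

theorem IsUniversalSpace.subgroup (hE : IsUniversalSpace G E) (H : Subgroup G) :
    IsUniversalSpace H E where
  contractible := hE.contractible
  free x := by
    obtain ⟨U, hU, h⟩ := hE.free x
    exact ⟨U, hU, fun g hg => Subtype.ext (h g hg)⟩

variable (R : Type) [CommRing R]

/-- Cochains on `BH` pull back to `H`-invariant cochains on `EG`. -/
theorem cochainRep_subgroup (H : Subgroup G) (n : ℕ)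
    (f : Cochain R (Sing (ClassifyingSpace H E)) n) (h : G) (hh : h ∈ H) :
    cochainRep R (singAction G E) n h (cochainPullback R (singProj H E) n f) =
      cochainPullback R (singProj H E) n f :=
  cochainRep_cochainPullback_singProj R n (⟨h, hh⟩ : H) f

variable {R}

/-- An invariant primitive on `EG` descends to `BG`, and injectivity of pullback to `EG` carries the
equation down with it. -/
theorem IsUniversalSpace.mem_coboundaries (hE : IsUniversalSpace G E) (n : ℕ)
    {f : Cochain R (Sing (ClassifyingSpace G E)) n} {b : Cochain R (Sing E) (n - 1)}
    (hb : ∀ g, cochainRep R (singAction G E) (n - 1) g b = b)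
    (h : coboundaryTo R (Sing E) n b = cochainPullback R (singProj G E) n f) :
    f ∈ coboundaries R (Sing (ClassifyingSpace G E)) n := by
  obtain ⟨b', rfl⟩ := hE.exists_cochainPullback_singProj_eq R _ b hb
  rw [coboundaryTo_cochainPullback] at h
  exact (mem_coboundaries_iff R).2 ⟨b', hE.cochainPullback_singProj_injective R n h⟩

theorem IsUniversalSpace.mem_cocycles (hE : IsUniversalSpace G E) (n : ℕ)
    {f : Cochain R (Sing (ClassifyingSpace G E)) n}
    (h : coboundary R (Sing E) n (cochainPullback R (singProj G E) n f) = 0) :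
    f ∈ cocycles R (Sing (ClassifyingSpace G E)) n := by
  rw [coboundary_cochainPullback] at h
  exact hE.cochainPullback_singProj_injective R (n + 1) (h.trans (map_zero _).symm)

omit [ContinuousConstSMul G E] in
theorem coboundary_singProj {n : ℕ}
    (f : cocycles R (Sing (ClassifyingSpace G E)) n) :
    coboundary R (Sing E) n (cochainPullback R (singProj G E) n f.1) = 0 := by
  rw [coboundary_cochainPullback, LinearMap.mem_ker.1 f.2, map_zero]

theorem mk_eq_zero_iff {S : SSet.{v}} {n : ℕ} (f : cocycles R S n) :
    (Submodule.Quotient.mk f : Cohomology R S n) = 0 ↔ f.1 ∈ coboundaries R S n :=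
  Submodule.Quotient.mk_eq_zero _

theorem mk_eq_mk_iff {S : SSet.{v}} {n : ℕ} (f g : cocycles R S n) :
    (Submodule.Quotient.mk f : Cohomology R S n) = Submodule.Quotient.mk g ↔
      f.1 - g.1 ∈ coboundaries R S n :=
  Submodule.Quotient.eq ((coboundaries R S n).comap (cocycles R S n).subtype)

theorem singularPullback_mk {X Y : Type v} [TopologicalSpace X] [TopologicalSpace Y]
    (φ : C(X, Y)) {n : ℕ} (f : cocycles R (Sing Y) n) :
    singularPullback R φ n (Submodule.Quotient.mk f) =
      Submodule.Quotient.mk (cocyclePullback R (TopCat.toSSet.map (TopCat.ofHom φ)) n f) := rfl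

/-- Cup products are natural. -/
theorem pullback_cup {S T : SSet.{v}} (φ : S ⟶ T) {m n l : ℕ} (h : m + n = l)
    (x : Cohomology R T m) (y : Cohomology R T n) :
    pullback R φ l (cup R T h x y) = cup R S h (pullback R φ m x) (pullback R φ n y) := by
  induction x using Submodule.Quotient.induction_on with
  | H f =>
    induction y using Submodule.Quotient.induction_on with
    | H g =>
      refine congrArg Submodule.Quotient.mk (Subtype.ext (funext fun σ => ?_))
      have h1 := NatTrans.naturality_apply φ
        (SimplexCategory.subinterval 0 m (show 0 + m ≤ l by omega)).op σ
      have h2 := NatTrans.naturality_apply φ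
        (SimplexCategory.subinterval m n (show m + n ≤ l by omega)).op σ
      exact (congrArg₂ (fun a b => f.1 a * g.1 b) h1 h2).symm

/-- A cochain on `BG` becoming a coboundary on `BV` is a coboundary, if `V` has invertible index. -/
theorem IsUniversalSpace.mem_coboundaries_of_index_ne_zero {k : Type} [Field k]
    (hE : IsUniversalSpace G E) (V : Subgroup G) [V.FiniteIndex] (hV : (V.index : k) ≠ 0) (n : ℕ)
    {f : Cochain k (Sing (ClassifyingSpace G E)) n} {b : Cochain k (Sing E) (n - 1)}
    (hb : ∀ v ∈ V, cochainRep k (singAction G E) (n - 1) v b = b)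
    (h : coboundaryTo k (Sing E) n b = cochainPullback k (singProj G E) n f) :
    f ∈ coboundaries k (Sing (ClassifyingSpace G E)) n := by
  obtain ⟨b', hb', h'⟩ := exists_invariant_of_index_ne_zero
    (cochainRep k (singAction G E) n) (cochainRep k (singAction G E) (n - 1))
    (coboundaryTo k (Sing E) n) (coboundaryTo_cochainRep k (singAction G E) n) V hV b hb
    (fun g => by rw [h, cochainRep_cochainPullback_singProj])
  exact hE.mem_coboundaries n hb' (h'.trans h)

variable {p : ℕ} [Fact p.Prime] [Finite G]

theorem index_cast_ne_zero (V : Sylow p G) : ((V : Subgroup G).index : ZMod p) ≠ 0 := by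
  rw [Ne, ZMod.natCast_eq_zero_iff]
  exact V.not_dvd_index

/-- A cocycle on `EG` invariant under an abelian Sylow subgroup `V`, whose class is invariant under
the normalizer, is cohomologous to the pullback of a cocycle on `BG`. -/
theorem IsUniversalSpace.exists_cocycle_of_stable (hE : IsUniversalSpace G E) (V : Sylow p G)
    (hV : ∀ x ∈ (V : Subgroup G), ∀ y ∈ (V : Subgroup G), x * y = y * x) (n : ℕ)
    (f : Cochain (ZMod p) (Sing E) n) (hf : coboundary (ZMod p) (Sing E) n f = 0)
    (hfV : ∀ v ∈ (V : Subgroup G), cochainRep (ZMod p) (singAction G E) n v f = f)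
    (hN : ∀ a ∈ Subgroup.normalizer ((V : Subgroup G) : Set G),
      ∃ b, (∀ v ∈ (V : Subgroup G), cochainRep (ZMod p) (singAction G E) (n - 1) v b = b) ∧
        coboundaryTo (ZMod p) (Sing E) n b = cochainRep (ZMod p) (singAction G E) n a f - f) :
    ∃ y : cocycles (ZMod p) (Sing (ClassifyingSpace G E)) n,
      ∃ b, (∀ v ∈ (V : Subgroup G), cochainRep (ZMod p) (singAction G E) (n - 1) v b = b) ∧
        coboundaryTo (ZMod p) (Sing E) n b = cochainPullback (ZMod p) (singProj G E) n y.1 - f := by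
  have := hE.contractible
  obtain ⟨C⟩ := nonempty_cochainContraction (ZMod p) E
  obtain ⟨y, hy, b, hb, hby⟩ := exists_invariant_sub_mem_boundaries
    (cochainRep (ZMod p) (singAction G E) n) (cochainRep (ZMod p) (singAction G E) (n - 1))
    (coboundaryTo (ZMod p) (Sing E) n) (coboundaryTo_cochainRep _ _ n) V hV
    (index_cast_ne_zero V) f hfV
    -- The cocycle `f` is `V`-invariant, hence `Q`-invariant, so the equivariant homotopy for `c`
    -- applies to it.
    (fun Q c hQ hc => exists_invariant_coboundaryTo_eq (singAction G E) C Q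
      (fun m g σ => hE.singAction_free m g σ) c hc n f hf fun q hq => hfV q (hQ hq))
    hN
  obtain ⟨y', rfl⟩ := hE.exists_cochainPullback_singProj_eq _ n y hy
  refine ⟨⟨y', hE.mem_cocycles n ?_⟩, b, hb, hby⟩
  -- The pullback of `y'` is a cocycle because it is `f` plus a coboundary.
  rw [← sub_add_cancel (cochainPullback _ _ n y') f, ← hby, map_add, hf, coboundary_coboundaryTo,
    add_zero]

/-- The restriction to a Sylow subgroup is injective. -/
theorem IsUniversalSpace.singularPullback_sylow_injective (hE : IsUniversalSpace G E)
    (V : Sylow p G) (n : ℕ) :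
    Function.Injective
      (singularPullback (ZMod p) (classifyingMap E (V : Subgroup G)) n) := by
  rw [injective_iff_map_eq_zero]
  intro x hx
  induction x using Submodule.Quotient.induction_on with
  | H f =>
    rw [singularPullback_mk, mk_eq_zero_iff] at hx
    obtain ⟨b, hb⟩ := (mem_coboundaries_iff _).1 hx
    refine (mk_eq_zero_iff f).2 (hE.mem_coboundaries_of_index_ne_zero (V : Subgroup G)
      (index_cast_ne_zero V) n (fun v hv => cochainRep_subgroup _ _ _ b v hv) ?_)
    rw [coboundaryTo_cochainPullback, hb]
    rfl

omit [Finite G] in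
theorem singularPullback_mem_invariants (V : Subgroup G) (n : ℕ)
    (x : SingularCohomology R (ClassifyingSpace G E) n) :
    singularPullback R (classifyingMap E V) n x ∈ (weylRep E V R n).invariants := by
  intro w
  induction w using QuotientGroup.induction_on with
  | H a =>
    have h : (classifyingMap E V).comp (conjMap E V a⁻¹) = classifyingMap E V := by
      ext y
      induction y using Quotient.inductionOn with
      | h y => exact Quotient.sound ⟨((a⁻¹ : Subgroup.normalizer (V : Set G)) : G), rfl⟩
    change singularPullback R (conjMap E V a⁻¹) n (singularPullback R (classifyingMap E V) n x) = _
    rw [← LinearMap.comp_apply, ← singularPullback_comp, h]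

/-- Every class on `BV` invariant under the Weyl group is a restriction from `BG`. -/
theorem IsUniversalSpace.exists_singularPullback_eq (hE : IsUniversalSpace G E) (V : Sylow p G)
    (hV : ∀ x ∈ (V : Subgroup G), ∀ y ∈ (V : Subgroup G), x * y = y * x) (n : ℕ)
    (x : SingularCohomology (ZMod p) (ClassifyingSpace (V : Subgroup G) E) n)
    (hx : x ∈ (weylRep E (V : Subgroup G) (ZMod p) n).invariants) :
    ∃ y, singularPullback (ZMod p) (classifyingMap E (V : Subgroup G)) n y = x := by
  have hEV := hE.subgroup (V : Subgroup G)
  induction x using Submodule.Quotient.induction_on with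
  | H f =>
    obtain ⟨y, b, hb, hby⟩ := hE.exists_cocycle_of_stable V hV n
      (cochainPullback (ZMod p) (singProj (V : Subgroup G) E) n f.1)
      (coboundary_singProj f)
      (fun v hv => cochainRep_subgroup _ _ n f.1 v hv)
      (fun a ha => by
        -- Weyl invariance gives a primitive on `BV`; its pullback to `EG` is the `V`-invariant
        -- primitive needed for stability.
        have h : singularPullback (ZMod p) (conjMap E (V : Subgroup G) ⟨a, ha⟩⁻¹) n
          (Submodule.Quotient.mk f) = Submodule.Quotient.mk f := hx (QuotientGroup.mk ⟨a, ha⟩)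
        rw [singularPullback_mk, mk_eq_mk_iff] at h
        obtain ⟨b, hb⟩ := (mem_coboundaries_iff _).1 h
        refine ⟨cochainPullback (ZMod p) (singProj (V : Subgroup G) E) (n - 1) b,
          fun v hv => cochainRep_subgroup _ _ _ b v hv, ?_⟩
        rw [coboundaryTo_cochainPullback, hb, map_sub]
        rfl)
    refine ⟨Submodule.Quotient.mk y, ?_⟩
    rw [singularPullback_mk, mk_eq_mk_iff]
    exact hEV.mem_coboundaries n (fun v => hb v v.2) (by rw [map_sub]; exact hby)

/-- The restriction to the normalizer of an abelian Sylow subgroup is bijective. -/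
theorem IsUniversalSpace.singularPullback_normalizer_bijective (hE : IsUniversalSpace G E)
    (V : Sylow p G)
    (hV : ∀ x ∈ (V : Subgroup G), ∀ y ∈ (V : Subgroup G), x * y = y * x) (n : ℕ) :
    Function.Bijective (singularPullback (ZMod p)
      (classifyingMap E (Subgroup.normalizer ((V : Subgroup G) : Set G))) n) := by
  set N := Subgroup.normalizer ((V : Subgroup G) : Set G)
  have hVN : (V : Subgroup G) ≤ N := Subgroup.le_normalizer
  constructor
  · rw [injective_iff_map_eq_zero]
    intro x hx
    induction x using Submodule.Quotient.induction_on with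
    | H f =>
      rw [singularPullback_mk, mk_eq_zero_iff] at hx
      obtain ⟨b, hb⟩ := (mem_coboundaries_iff _).1 hx
      refine (mk_eq_zero_iff f).2 (hE.mem_coboundaries_of_index_ne_zero (V : Subgroup G)
        (index_cast_ne_zero V) n (fun v hv => cochainRep_subgroup _ N _ b v (hVN hv)) ?_)
      rw [coboundaryTo_cochainPullback, hb]
      rfl
  · intro x
    induction x using Submodule.Quotient.induction_on with
    | H f =>
      obtain ⟨y, b, hb, hby⟩ := hE.exists_cocycle_of_stable V hV n
        (cochainPullback (ZMod p) (singProj N E) n f.1)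
        (coboundary_singProj f)
        (fun v hv => cochainRep_subgroup _ N n f.1 v (hVN hv))
        -- A cochain from `BN` is fixed by the normalizer on the nose, so the zero primitive
        -- suffices.
        (fun a ha => ⟨0, fun v _ => map_zero _, by
          rw [map_zero, cochainRep_subgroup _ N n f.1 a ha, sub_self]⟩)
      refine ⟨Submodule.Quotient.mk y, ?_⟩
      rw [singularPullback_mk, mk_eq_mk_iff]
      -- The primitive is only `V`-invariant. Transfer from `V` to `N` corrects this, since the
      -- index of `V` in `N` divides its index in `G`.
      refine (hE.subgroup N).mem_coboundaries_of_index_ne_zero ((V : Subgroup G).subgroupOf N)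
        (fun h => index_cast_ne_zero V ?_) n (fun v hv => hb v (Subgroup.mem_subgroupOf.1 hv))
        (by rw [map_sub]; exact hby)
      rw [← Subgroup.relIndex_mul_index hVN, Nat.cast_mul]
      exact mul_eq_zero_of_left h _

end Restriction

end ModPCoh

end

theorem theoremt1 (p : ℕ) [Fact p.Prime] {G : Type u} [Group G] [Finite G]
    (V : Sylow p G) (hV : ModPCoh.IsElementaryAbelian p (V : Subgroup G))
    (E : Type v) [TopologicalSpace E] [MulAction G E] [ContinuousConstSMul G E]
    (hE : ModPCoh.IsUniversalSpace G E) :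
    (∃ e : ∀ n : ℕ, ModPCoh.SingularCohomology (ZMod p) (ModPCoh.ClassifyingSpace G E) n ≃ₗ[ZMod p]
        (ModPCoh.weylRep E (V : Subgroup G) (ZMod p) n).invariants,
      (∀ (n : ℕ) (x : ModPCoh.SingularCohomology (ZMod p) (ModPCoh.ClassifyingSpace G E) n),
        (e n x).1 =
          ModPCoh.singularPullback (ZMod p) (ModPCoh.classifyingMap E (V : Subgroup G)) n x) ∧
      (e 0 (ModPCoh.unitClass (ZMod p) (ModPCoh.Sing (ModPCoh.ClassifyingSpace G E)))).1 =
        ModPCoh.unitClass (ZMod p)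
          (ModPCoh.Sing (ModPCoh.ClassifyingSpace (V : Subgroup G) E)) ∧
      (∀ (m n k : ℕ) (h : m + n = k)
        (x : ModPCoh.SingularCohomology (ZMod p) (ModPCoh.ClassifyingSpace G E) m)
        (y : ModPCoh.SingularCohomology (ZMod p) (ModPCoh.ClassifyingSpace G E) n),
        (e k (ModPCoh.cup (ZMod p) (ModPCoh.Sing (ModPCoh.ClassifyingSpace G E)) h x y)).1 =
          ModPCoh.cup (ZMod p) (ModPCoh.Sing (ModPCoh.ClassifyingSpace (V : Subgroup G) E)) h
            (e m x).1 (e n y).1)) ∧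
    ModPCoh.IsHZModEquivalence p
      (ModPCoh.classifyingMap E (Subgroup.normalizer ((V : Subgroup G) : Set G))) := by
  refine ⟨⟨fun n => LinearEquiv.ofBijective
    ((ModPCoh.singularPullback (ZMod p) (ModPCoh.classifyingMap E (V : Subgroup G)) n).codRestrict _
      (ModPCoh.singularPullback_mem_invariants (V : Subgroup G) n)) ⟨fun x y h => ?_, fun x => ?_⟩,
    fun n x => rfl, rfl, fun m n k h x y => ?_⟩, fun n => ?_⟩
  · exact hE.singularPullback_sylow_injective V n (congrArg Subtype.val h)
  · obtain ⟨y, hy⟩ := hE.exists_singularPullback_eq V hV.1 n x.1 x.2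
    exact ⟨y, Subtype.ext hy⟩
  · exact ModPCoh.pullback_cup _ h x y
  · exact ModPCoh.isIso_homologyMap_of_bijective_pullback _ n
      (hE.singularPullback_normalizer_bijective V hV.1 n)
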